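/- Let $M$ be a smooth manifold (Hausdorff, $\sigma$-compact) and let $\mathcal E=\{\mathcal E_k\}_{k=-n}^{-1}$ ($n\ge 0$) be a graded manifold over $M$, i.e. a family of smooth vector bundles of finite rank over $M$, $\mathcal E_k$ being of degree $k$. Let $\mathcal C^\infty(\mathcal E)=\Gamma(S(\mathcal E^*))$ be its graded commutative algebra of functions, where $(\mathcal E^*)_k=(\mathcal E_{-k})^*$ and $S$ is the graded symmetric algebra; vector fields on $\mathcal E$ are the graded derivations of $\mathcal C^\infty(\mathcal E)$. Let $\mathfrak X(\mathcal E)=\bigoplus_{l\ge 0}\mathfrak X^l(\mathcal E)$ be the algebra of multi-vector fields, i.e. the graded symmetric algebra over $\mathcal C^\infty(\mathcal E)$ of the module of vector fields shifted by $[-1]$, with product $\wedge$; $\mathfrak X^l(\mathcal E)$ is the part of multiplicity $l$. For a multi-vector field $Z$ of degree $|Z|$ and multiplicity $l$ put $|Z|_{\mathrm{total}}=|Z|+l$ and $\|Z\|=|Z|+l-1$, and let $\mathfrak X_k(\mathcal E)$ be the space of multi-vector fields with $\|Z\|=k$. The Schouten–Nijenhuis bracket $[\cdot,\cdot]_{\mathrm{SN}}$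 is the unique bilinear operation on $\mathfrak X(\mathcal E)$ with $[f,g]_{\mathrm{SN}}=0$, $[X,f]_{\mathrm{SN}}=X(f)$ and $[X,Y]_{\mathrm{SN}}=X\circ Y-(-1)^{|X||Y|}Y\circ X$ for homogeneous functions $f,g$ and vector fields $X,Y$, and with $[Z_1,Z_2]_{\mathrm{SN}}=-(-1)^{\|Z_1\|\|Z_2\|}[Z_2,Z_1]_{\mathrm{SN}}$ and $[Z,Z_1\wedge Z_2]_{\mathrm{SN}}=[Z,Z_1]_{\mathrm{SN}}\wedge Z_2+(-1)^{\|Z\|\,|Z_1|_{\mathrm{total}}}Z_1\wedge[Z,Z_2]_{\mathrm{SN}}$ for homogeneous $Z,Z_1,Z_2\in\mathfrak X(\mathcal E)$. A blended homological vector field is a sum $Q=Q^++Q^-$ with $Q^+\in\mathfrak X_1(\mathcal E)$, $Q^-\in\mathfrak X_{-1}(\mathcal E)$ and $[Q^+,Q^+]_{\mathrm{SN}}=[Q^-,Q^-]_{\mathrm{SN}}=[Q^+,Q^-]_{\mathrm{SN}}=0$. A deformation of $Q$ is an element $\tilde Q=\tilde Q^++\tilde Q^-\in\mathfrak X_1(\mathcal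 E)\oplus\mathfrak X_{-1}(\mathcal E)$ such that $Q+\tilde Q$ is again a blended homological vector field. A blended DGLA $(V,[\cdot,\cdot],d^+,d^-)$ is a $\mathbb Z$-graded Lie algebra with derivations $d^\pm$ of degree $\pm1$ such that $(d^+)^2=(d^-)^2=d^+d^-+d^-d^+=0$; its Maurer–Cartan elements are the $v=v_++v_-$ with $v_\pm\in V_{\pm1}$ and $(d^++d^-)v+\tfrac12[v,v]=0$. Let $Q=Q^++Q^-$ be a blended homological vector field on $\mathcal E$. (1) $\mathfrak X(\mathcal E)$, graded by $\|\cdot\|$, with $[\cdot,\cdot]_{\mathrm{SN}}$ and $d^\pm=[Q^\pm,\cdot]_{\mathrm{SN}}$, is a blended DGLA, and $\tilde Q\in\mathfrak X(\mathcal E)$ is a deformation of $Q$ if and only if it is a Maurer–Cartan element of this blended DGLA. (2) If $Q\in\mathfrak X^1(\mathcal E)$, then the bracket and $d^\pm$ restrict to $\mathfrak X^1(\mathcal E)$ and make it a blended DGLA, and $\tilde Q\in\mathfrak X^1(\mathcal E)$ is a deformation of $Q$ if and only if it is a Maurer–Cartan element of $\mathfrak X^1(\mathcal E)$. -/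

import Mathlib

open scoped Manifold ContDiff Topology DirectSum

noncomputable section

namespace BlendedQ

universe u v

/-! ### Algebras generated by homogeneous elements -/

section Generated

variable {R : Type*} [Ring R] [Algebra ℝ R] {G : Type*} (γ : G → R) (deg : G → ℤ)

/-- The span of all products `γ g₁ * ⋯ * γ gᵣ` with `deg g₁ + ⋯ + deg gᵣ = k`. -/
def degPart (k : ℤ) : Submodule ℝ R :=
  Submodule.span ℝ {z | ∃ L : List G, (L.map deg).sum = k ∧ (L.map γ).prod = z}

variable {γ deg}

theorem prod_mem_degPart (L : List G) : (L.map γ).prod ∈ degPart γ deg (L.map deg).sum :=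
  Submodule.subset_span ⟨L, rfl, rfl⟩

theorem gen_mem_degPart (g : G) : γ g ∈ degPart γ deg (deg g) := by
  simpa using prod_mem_degPart (γ := γ) (deg := deg) [g]

theorem one_mem_degPart : (1 : R) ∈ degPart γ deg 0 := by
  simpa using prod_mem_degPart (γ := γ) (deg := deg) []

theorem mul_mem_degPart {i j : ℤ} {a b : R} (ha : a ∈ degPart γ deg i)
    (hb : b ∈ degPart γ deg j) : a * b ∈ degPart γ deg (i + j) := by
  induction ha using Submodule.span_induction with
  | zero => simp
  | add x y _ _ hx hy => rw [add_mul]; exact add_mem hx hy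
  | smul r x _ hx => rw [smul_mul_assoc]; exact Submodule.smul_mem _ _ hx
  | mem x hx =>
    obtain ⟨L, rfl, rfl⟩ := hx
    induction hb using Submodule.span_induction with
    | zero => simp
    | add x y _ _ hx hy => rw [mul_add]; exact add_mem hx hy
    | smul r x _ hx => rw [mul_smul_comm]; exact Submodule.smul_mem _ _ hx
    | mem y hy =>
      obtain ⟨K, rfl, rfl⟩ := hy
      simpa using prod_mem_degPart (γ := γ) (deg := deg) (L ++ K)

theorem neg_one_zpow_ite (k : ℤ) : (-1 : ℝ) ^ k = if Even k then 1 else -1 := by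
  split_ifs with h
  · exact h.neg_one_zpow
  · exact (Int.not_even_iff_odd.1 h).neg_one_zpow

theorem degPart_comm (hγ : ∀ g h, γ g * γ h = (-1 : ℝ) ^ (deg g * deg h) • (γ h * γ g))
    {i j : ℤ} {a b : R} (ha : a ∈ degPart γ deg i) (hb : b ∈ degPart γ deg j) :
    a * b = (-1 : ℝ) ^ (i * j) • (b * a) := by
  have key (g : G) (K : List G) :
      γ g * (K.map γ).prod = (-1 : ℝ) ^ (deg g * (K.map deg).sum) • ((K.map γ).prod * γ g) := by
    induction K with
    | nil => simp
    | cons h K ih =>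
      simp only [List.map_cons, List.prod_cons, List.sum_cons]
      rw [← mul_assoc, hγ, smul_mul_assoc, mul_assoc, ih, mul_smul_comm, smul_smul, ← mul_assoc,
        mul_add, zpow_add₀ (by norm_num)]
  induction ha using Submodule.span_induction with
  | zero => simp
  | add x y _ _ hx hy => rw [add_mul, mul_add, hx, hy, smul_add]
  | smul r x _ hx => rw [smul_mul_assoc, mul_smul_comm, hx, smul_comm]
  | mem x hx =>
    obtain ⟨L, rfl, rfl⟩ := hx
    induction hb using Submodule.span_induction with
    | zero => simp
    | add x y _ _ hx hy => rw [mul_add, add_mul, hx, hy, smul_add]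
    | smul r x _ hx => rw [smul_mul_assoc, mul_smul_comm, hx, smul_comm]
    | mem y hy =>
      obtain ⟨K, rfl, rfl⟩ := hy
      induction L with
      | nil => simp
      | cons g L ih =>
        simp only [List.map_cons, List.prod_cons, List.sum_cons]
        rw [mul_assoc, ih, mul_smul_comm, ← mul_assoc, key, smul_mul_assoc, smul_smul, mul_assoc,
          add_mul, zpow_add₀ (by norm_num), mul_comm ((-1 : ℝ) ^ _)]

end Generated

/-! ### Vector fields: graded derivations of a graded commutative algebra -/

section Derivations

variable {A : Type u} [Ring A] [Algebra ℝ A] (𝒜 : ℤ → Submodule ℝ A)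

/-- A family of subspaces `𝒜 k` of an algebra, multiplicative and graded commutative. -/
class IsGradedComm : Prop extends SetLike.GradedMonoid 𝒜 where
  comm : ∀ {i j : ℤ} {a b : A}, a ∈ 𝒜 i → b ∈ 𝒜 j → a * b = (-1 : ℝ) ^ (i * j) • (b * a)

/-- Vector fields of degree `k`: linear maps of degree `k` with the graded Leibniz rule. (When the
`𝒜 j` span `A`, it is equivalent by linearity to ask the rule for homogeneous `g` only.) -/
def vectorFields (k : ℤ) : Submodule ℝ (A →ₗ[ℝ] A) where
  carrier := {X | (∀ i, ∀ f ∈ 𝒜 i, X f ∈ 𝒜 (i + k)) ∧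
    ∀ i, ∀ f ∈ 𝒜 i, ∀ g, X (f * g) = X f * g + (-1 : ℝ) ^ (k * i) • (f * X g)}
  zero_mem' := by simp
  add_mem' := by
    rintro X Y ⟨hX, hX'⟩ ⟨hY, hY'⟩
    refine ⟨fun i f hf => add_mem (hX i f hf) (hY i f hf), fun i f hf g => ?_⟩
    simp only [LinearMap.add_apply, hX' i f hf g, hY' i f hf g, add_mul, mul_add,
      smul_add]
    abel
  smul_mem' := by
    rintro r X ⟨hX, hX'⟩
    refine ⟨fun i f hf => Submodule.smul_mem _ _ (hX i f hf), fun i f hf g => ?_⟩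
    simp only [LinearMap.smul_apply, hX' i f hf g, smul_add, smul_mul_assoc, mul_smul_comm]
    rw [smul_comm r]

variable {𝒜}

/-- The function `X f`. -/
def applyFn {k i : ℤ} (X : vectorFields 𝒜 k) (f : 𝒜 i) : 𝒜 (i + k) :=
  ⟨X.1 f.1, X.2.1 i f.1 f.2⟩

/-- The product `f g` of two functions. -/
def mulFn [IsGradedComm 𝒜] {i j : ℤ} (f : 𝒜 i) (g : 𝒜 j) : 𝒜 (i + j) :=
  ⟨f.1 * g.1, SetLike.mul_mem_graded f.2 g.2⟩

/-- The vector field `f X`, given by `(f X)(g) = f X(g)`. -/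
def smulVec [IsGradedComm 𝒜] {i k : ℤ} (f : 𝒜 i) (X : vectorFields 𝒜 k) :
    vectorFields 𝒜 (i + k) :=
  ⟨LinearMap.mulLeft ℝ f.1 ∘ₗ X.1, by
    refine ⟨fun j g hg => ?_, fun j g hg h => ?_⟩
    · have := SetLike.mul_mem_graded f.2 (X.2.1 j g hg)
      rwa [add_left_comm] at this
    · simp only [LinearMap.comp_apply, LinearMap.mulLeft_apply, X.2.2 j g hg h, mul_add,
        mul_smul_comm, ← mul_assoc]
      rw [IsGradedComm.comm f.2 hg, smul_mul_assoc, smul_smul, add_mul,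
        zpow_add₀ (by norm_num), mul_comm]⟩

/-- The graded commutator `X ∘ Y - (-1)^{kl} Y ∘ X` of two vector fields. -/
def commutator {k l : ℤ} (X : vectorFields 𝒜 k) (Y : vectorFields 𝒜 l) :
    vectorFields 𝒜 (k + l) :=
  ⟨X.1 ∘ₗ Y.1 - (-1 : ℝ) ^ (k * l) • (Y.1 ∘ₗ X.1), by
    refine ⟨fun i f hf => ?_, fun i f hf g => ?_⟩
    · have h1 := X.2.1 _ _ (Y.2.1 i f hf)
      have h2 := Y.2.1 _ _ (X.2.1 i f hf)
      rw [add_assoc, add_comm l k] at h1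
      rw [add_assoc] at h2
      exact sub_mem h1 (Submodule.smul_mem _ _ h2)
    · simp only [LinearMap.sub_apply, LinearMap.smul_apply, LinearMap.comp_apply,
        X.2.2 i f hf g, Y.2.2 i f hf g, map_add, map_smul,
        X.2.2 _ _ (Y.2.1 i f hf) g, Y.2.2 _ _ (X.2.1 i f hf) g,
        X.2.2 i f hf (Y.1 g), Y.2.2 i f hf (X.1 g)]
      simp only [neg_one_zpow_ite, mul_add, Int.even_add, Int.even_mul, sub_mul, smul_mul_assoc,
        mul_sub, smul_add, smul_sub, mul_smul_comm, smul_smul]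
      by_cases hk : Even k <;> by_cases hl : Even l <;> by_cases hi : Even i <;>
        simp [hk, hl, hi] <;> abel⟩

end Derivations

/-! ### Multi-vector fields -/

section MultiVector

variable {A : Type u} [Ring A] [Algebra ℝ A] (𝒜 : ℤ → Submodule ℝ A)

/-- Homogeneous generators of the algebra of multi-vector fields: functions and vector fields. -/
inductive Gen : Type u
  | fn (k : ℤ) (f : 𝒜 k) : Gen
  | vec (k : ℤ) (X : vectorFields 𝒜 k) : Gen

variable {𝒜} in
/-- The total degree `|Z| + l`: the degree for functions, the degree plus one for vector fields. -/
def Gen.totalDeg : Gen 𝒜 → ℤ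
  | fn k _ => k
  | vec k _ => k + 1

variable {𝒜} in
/-- The multiplicity. -/
def Gen.mult : Gen 𝒜 → ℤ
  | fn _ _ => 0
  | vec _ _ => 1

open Gen in
/-- The relations presenting the graded symmetric algebra `S_A(𝒱[-1])` of the `A`-module of vector
fields, shifted by one, over the algebra `A` of functions. -/
inductive MVRel [IsGradedComm 𝒜] : FreeAlgebra ℝ (Gen 𝒜) → FreeAlgebra ℝ (Gen 𝒜) → Prop
  | fn_add (k : ℤ) (f g : 𝒜 k) :
      MVRel (.ι ℝ (fn k (f + g))) (.ι ℝ (fn k f) + .ι ℝ (fn k g))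
  | fn_smul (k : ℤ) (r : ℝ) (f : 𝒜 k) : MVRel (.ι ℝ (fn k (r • f))) (r • .ι ℝ (fn k f))
  | fn_one : MVRel (.ι ℝ (fn 0 ⟨1, SetLike.one_mem_graded 𝒜⟩)) 1
  | fn_mul (i j : ℤ) (f : 𝒜 i) (g : 𝒜 j) :
      MVRel (.ι ℝ (fn (i + j) (mulFn f g))) (.ι ℝ (fn i f) * .ι ℝ (fn j g))
  | vec_add (k : ℤ) (X Y : vectorFields 𝒜 k) :
      MVRel (.ι ℝ (vec k (X + Y))) (.ι ℝ (vec k X) + .ι ℝ (vec k Y))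
  | vec_smul (k : ℤ) (r : ℝ) (X : vectorFields 𝒜 k) :
      MVRel (.ι ℝ (vec k (r • X))) (r • .ι ℝ (vec k X))
  | fn_smul_vec (i k : ℤ) (f : 𝒜 i) (X : vectorFields 𝒜 k) :
      MVRel (.ι ℝ (vec (i + k) (smulVec f X))) (.ι ℝ (fn i f) * .ι ℝ (vec k X))
  | comm (g h : Gen 𝒜) :
      MVRel (.ι ℝ g * .ι ℝ h) ((-1 : ℝ) ^ (g.totalDeg * h.totalDeg) • (.ι ℝ h * .ι ℝ g))

variable [IsGradedComm 𝒜]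

/-- Multi-vector fields: the graded symmetric algebra of the shifted module of vector fields over
the algebra of functions. Its product is the wedge product. On a graded manifold over a
`σ`-compact base the vector fields form a finitely generated projective module over the functions,
and this is the algebra of global sections of the bundle `S(T[-1])`. -/
def MultiVec : Type u := RingQuot (MVRel 𝒜)

instance : Ring (MultiVec 𝒜) := inferInstanceAs (Ring (RingQuot (MVRel 𝒜)))
instance : Algebra ℝ (MultiVec 𝒜) := inferInstanceAs (Algebra ℝ (RingQuot (MVRel 𝒜)))

variable {𝒜} in
/-- A generator, seen as a multi-vector field. -/
def gen (g : Gen 𝒜) : MultiVec 𝒜 := RingQuot.mkAlgHom ℝ (MVRel 𝒜) (FreeAlgebra.ι ℝ g)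

/-- A function, seen as a multi-vector field of multiplicity `0`. -/
abbrev ofFn {k : ℤ} (f : 𝒜 k) : MultiVec 𝒜 := gen (Gen.fn k f)

/-- A vector field, seen as a multi-vector field of multiplicity `1`. -/
abbrev ofVec {k : ℤ} (X : vectorFields 𝒜 k) : MultiVec 𝒜 := gen (Gen.vec k X)

/-- Multi-vector fields of total degree `k`. -/
def totalPart (k : ℤ) : Submodule ℝ (MultiVec 𝒜) := degPart gen Gen.totalDeg k

/-- Multi-vector fields `Z` of shifted degree `‖Z‖ = k`, i.e. of total degree `k + 1`. -/
def shiftedPart (k : ℤ) : Submodule ℝ (MultiVec 𝒜) := totalPart 𝒜 (k + 1)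

/-- Multi-vector fields of multiplicity `l`. -/
def multPart (l : ℤ) : Submodule ℝ (MultiVec 𝒜) := degPart gen Gen.mult l


variable {𝒜}

/-- The Schouten-Nijenhuis bracket, determined by its values on functions and vector fields,
graded antisymmetry, and the graded Leibniz rule for the wedge product. -/
structure IsSchoutenNijenhuis (br : MultiVec 𝒜 →ₗ[ℝ] MultiVec 𝒜 →ₗ[ℝ] MultiVec 𝒜) : Prop where
  fn_fn : ∀ {i j : ℤ} (f : 𝒜 i) (g : 𝒜 j), br (ofFn 𝒜 f) (ofFn 𝒜 g) = 0
  vec_fn : ∀ {k i : ℤ} (X : vectorFields 𝒜 k) (f : 𝒜 i),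
    br (ofVec 𝒜 X) (ofFn 𝒜 f) = ofFn 𝒜 (applyFn X f)
  vec_vec : ∀ {k l : ℤ} (X : vectorFields 𝒜 k) (Y : vectorFields 𝒜 l),
    br (ofVec 𝒜 X) (ofVec 𝒜 Y) = ofVec 𝒜 (commutator X Y)
  antisymm : ∀ {i j : ℤ} {Z₁ Z₂ : MultiVec 𝒜}, Z₁ ∈ totalPart 𝒜 i → Z₂ ∈ totalPart 𝒜 j →
    br Z₁ Z₂ = -((-1 : ℝ) ^ ((i - 1) * (j - 1)) • br Z₂ Z₁)
  leibniz : ∀ {i j : ℤ} {Z Z₁ : MultiVec 𝒜}, Z ∈ totalPart 𝒜 i → Z₁ ∈ totalPart 𝒜 j →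
    ∀ Z₂, br Z (Z₁ * Z₂) = br Z Z₁ * Z₂ + (-1 : ℝ) ^ ((i - 1) * j) • (Z₁ * br Z Z₂)

/-! The existence and uniqueness of the bracket. -/

theorem gen_rel {x y : FreeAlgebra ℝ (Gen 𝒜)} (h : MVRel 𝒜 x y) :
    RingQuot.mkAlgHom ℝ (MVRel 𝒜) x = RingQuot.mkAlgHom ℝ (MVRel 𝒜) y :=
  RingQuot.mkAlgHom_rel ℝ h

theorem ofFn_add {k : ℤ} (f g : 𝒜 k) : ofFn 𝒜 (f + g) = ofFn 𝒜 f + ofFn 𝒜 g :=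
  (gen_rel (.fn_add k f g)).trans (map_add _ _ _)

theorem ofFn_smul {k : ℤ} (r : ℝ) (f : 𝒜 k) : ofFn 𝒜 (r • f) = r • ofFn 𝒜 f :=
  (gen_rel (.fn_smul k r f)).trans (map_smul _ _ _)

theorem ofFn_one : ofFn 𝒜 (⟨1, SetLike.one_mem_graded 𝒜⟩ : 𝒜 0) = 1 :=
  (gen_rel .fn_one).trans (map_one _)

theorem ofFn_mul {i j : ℤ} (f : 𝒜 i) (g : 𝒜 j) : ofFn 𝒜 (mulFn f g) = ofFn 𝒜 f * ofFn 𝒜 g :=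
  (gen_rel (.fn_mul i j f g)).trans (map_mul _ _ _)

theorem ofVec_add {k : ℤ} (X Y : vectorFields 𝒜 k) :
    ofVec 𝒜 (X + Y) = ofVec 𝒜 X + ofVec 𝒜 Y :=
  (gen_rel (.vec_add k X Y)).trans (map_add _ _ _)

theorem ofVec_smul {k : ℤ} (r : ℝ) (X : vectorFields 𝒜 k) : ofVec 𝒜 (r • X) = r • ofVec 𝒜 X :=
  (gen_rel (.vec_smul k r X)).trans (map_smul _ _ _)

theorem ofVec_smulVec {i k : ℤ} (f : 𝒜 i) (X : vectorFields 𝒜 k) :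
    ofVec 𝒜 (smulVec f X) = ofFn 𝒜 f * ofVec 𝒜 X :=
  (gen_rel (.fn_smul_vec i k f X)).trans (map_mul _ _ _)

theorem gen_comm (g h : Gen 𝒜) :
    gen g * gen h = (-1 : ℝ) ^ (g.totalDeg * h.totalDeg) • (gen h * gen g) := by
  have := gen_rel (MVRel.comm g h)
  rwa [map_smul, map_mul, map_mul] at this

theorem ofFn_eq {i j : ℤ} (h : i = j) (f : 𝒜 i) (g : 𝒜 j) (hfg : f.1 = g.1) :
    ofFn 𝒜 f = ofFn 𝒜 g := by
  subst h
  rw [Subtype.ext hfg]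

theorem ofVec_eq {i j : ℤ} (h : i = j) (X : vectorFields 𝒜 i) (Y : vectorFields 𝒜 j)
    (hXY : X.1 = Y.1) : ofVec 𝒜 X = ofVec 𝒜 Y := by
  subst h
  rw [Subtype.ext hXY]

theorem ofFn_comb {i j l : ℤ} (hi : l = i) (hj : l = j) (r : ℝ) (h : 𝒜 l) (f : 𝒜 i) (g : 𝒜 j)
    (hfg : h.1 = f.1 + r • g.1) : ofFn 𝒜 h = ofFn 𝒜 f + r • ofFn 𝒜 g := by
  subst hi hj
  rw [← ofFn_smul, ← ofFn_add]
  exact ofFn_eq rfl _ _ hfg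

theorem ofVec_comb {i j l : ℤ} (hi : l = i) (hj : l = j) (r : ℝ) (Z : vectorFields 𝒜 l)
    (X : vectorFields 𝒜 i) (Y : vectorFields 𝒜 j) (h : Z.1 = X.1 + r • Y.1) :
    ofVec 𝒜 Z = ofVec 𝒜 X + r • ofVec 𝒜 Y := by
  subst hi hj
  rw [← ofVec_smul, ← ofVec_add]
  exact ofVec_eq rfl _ _ h

theorem totalPart_comm {i j : ℤ} {a b : MultiVec 𝒜} (ha : a ∈ totalPart 𝒜 i)
    (hb : b ∈ totalPart 𝒜 j) : a * b = (-1 : ℝ) ^ (i * j) • (b * a) :=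
  degPart_comm gen_comm ha hb

theorem gen_mem (g : Gen 𝒜) : gen g ∈ totalPart 𝒜 g.totalDeg := gen_mem_degPart g

theorem mul_mem_totalPart {i j : ℤ} {a b : MultiVec 𝒜} (ha : a ∈ totalPart 𝒜 i)
    (hb : b ∈ totalPart 𝒜 j) : a * b ∈ totalPart 𝒜 (i + j) := mul_mem_degPart ha hb

instance : SetLike.GradedMonoid (totalPart 𝒜) where
  one_mem := one_mem_degPart
  mul_mem _ _ _ _ := mul_mem_degPart

/-- Algebra homomorphisms out of the algebra of multi-vector fields. -/
theorem exists_hom {B : Type*} [Ring B] [Algebra ℝ B] (φ : Gen 𝒜 → B)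
    (h : ∀ x y, MVRel 𝒜 x y → FreeAlgebra.lift ℝ φ x = FreeAlgebra.lift ℝ φ y) :
    ∃ Φ : MultiVec 𝒜 →ₐ[ℝ] B, ∀ g, Φ (gen g) = φ g :=
  ⟨RingQuot.liftAlgHom ℝ ⟨FreeAlgebra.lift ℝ φ, h⟩, fun g => by
    erw [RingQuot.liftAlgHom_mkAlgHom_apply]
    simp⟩

theorem span_words : Submodule.span ℝ (Set.range fun L : List (Gen 𝒜) => (L.map gen).prod) =
    (⊤ : Submodule ℝ (MultiVec 𝒜)) := by
  rw [eq_top_iff]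
  rintro z -
  obtain ⟨x, rfl⟩ := RingQuot.mkAlgHom_surjective ℝ (MVRel 𝒜) z
  have hmul : ∀ a b : MultiVec 𝒜,
      a ∈ Submodule.span ℝ (Set.range fun L : List (Gen 𝒜) => (L.map gen).prod) →
      b ∈ Submodule.span ℝ (Set.range fun L : List (Gen 𝒜) => (L.map gen).prod) →
      a * b ∈ Submodule.span ℝ (Set.range fun L : List (Gen 𝒜) => (L.map gen).prod) := by
    intro a b ha hb
    have := Submodule.mul_mem_mul ha hb
    rw [Submodule.span_mul_span] at this
    refine Submodule.span_mono ?_ this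
    rintro _ ⟨_, ⟨L, rfl⟩, _, ⟨K, rfl⟩, rfl⟩
    exact ⟨L ++ K, by simp⟩
  have hone : (1 : MultiVec 𝒜) ∈
      Submodule.span ℝ (Set.range fun L : List (Gen 𝒜) => (L.map gen).prod) :=
    Submodule.subset_span ⟨[], by simp⟩
  induction x using FreeAlgebra.induction with
  | grade0 r =>
    rw [AlgHom.commutes, Algebra.algebraMap_eq_smul_one]
    exact Submodule.smul_mem _ _ hone
  | grade1 g => exact Submodule.subset_span ⟨[g], by simp; rfl⟩
  | mul a b ha hb => rw [map_mul]; exact hmul _ _ ha hb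
  | add a b ha hb => rw [map_add]; exact add_mem ha hb

theorem linearMap_ext_words {B : Type*} [AddCommGroup B] [Module ℝ B]
    {D D' : MultiVec 𝒜 →ₗ[ℝ] B}
    (h : ∀ L : List (Gen 𝒜), D (L.map gen).prod = D' (L.map gen).prod) : D = D' :=
  LinearMap.ext_on span_words (by rintro _ ⟨L, rfl⟩; exact h L)

/-- Derivations of degree `k` of the wedge product. -/
def IsDer (k : ℤ) (D : MultiVec 𝒜 →ₗ[ℝ] MultiVec 𝒜) : Prop :=
  ∀ j, ∀ s ∈ totalPart 𝒜 j, ∀ t, D (s * t) = D s * t + (-1 : ℝ) ^ (k * j) • (s * D t)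

theorem IsDer.map_one {k : ℤ} {D : MultiVec 𝒜 →ₗ[ℝ] MultiVec 𝒜} (h : IsDer k D) : D 1 = 0 := by
  have := h 0 1 one_mem_degPart 1
  simpa using this

theorem IsDer.ext {k : ℤ} {D D' : MultiVec 𝒜 →ₗ[ℝ] MultiVec 𝒜} (h : IsDer k D) (h' : IsDer k D')
    (hg : ∀ g, D (gen g) = D' (gen g)) : D = D' := by
  refine linearMap_ext_words fun L => ?_
  induction L with
  | nil => simp [h.map_one, h'.map_one]
  | cons g L ih =>
    simp only [List.map_cons, List.prod_cons]
    rw [h _ _ (gen_mem g), h' _ _ (gen_mem g), hg, ih]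

theorem IsDer.mem {k : ℤ} {D : MultiVec 𝒜 →ₗ[ℝ] MultiVec 𝒜} (h : IsDer k D)
    (hg : ∀ g, D (gen g) ∈ totalPart 𝒜 (k + g.totalDeg)) {i : ℤ} {z : MultiVec 𝒜}
    (hz : z ∈ totalPart 𝒜 i) : D z ∈ totalPart 𝒜 (k + i) := by
  induction hz using Submodule.span_induction with
  | zero => simp
  | add x y _ _ hx hy => rw [_root_.map_add]; exact add_mem hx hy
  | smul r x _ hx => rw [_root_.map_smul]; exact Submodule.smul_mem _ _ hx
  | mem x hx =>
    obtain ⟨L, rfl, rfl⟩ := hx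
    induction L with
    | nil => simp [h.map_one]
    | cons g L ih =>
      simp only [List.map_cons, List.prod_cons, List.sum_cons]
      rw [h _ _ (gen_mem g)]
      refine add_mem ?_ (Submodule.smul_mem _ _ ?_)
      · rw [← add_assoc]
        exact mul_mem_totalPart (hg g) (prod_mem_degPart L)
      · rw [add_left_comm]
        exact mul_mem_totalPart (gen_mem g) ih

theorem IsDer.add {k : ℤ} {D D' : MultiVec 𝒜 →ₗ[ℝ] MultiVec 𝒜} (h : IsDer k D)
    (h' : IsDer k D') : IsDer k (D + D') := by
  intro j s hs t
  simp only [LinearMap.add_apply, h j s hs t, h' j s hs t, add_mul, mul_add, smul_add]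
  abel

theorem IsDer.smul {k : ℤ} {D : MultiVec 𝒜 →ₗ[ℝ] MultiVec 𝒜} (h : IsDer k D) (r : ℝ) :
    IsDer k (r • D) := by
  intro j s hs t
  simp only [LinearMap.smul_apply, h j s hs t, smul_add, smul_mul_assoc, mul_smul_comm]
  rw [smul_comm r]

theorem IsDer.mulLeft {k i : ℤ} {D : MultiVec 𝒜 →ₗ[ℝ] MultiVec 𝒜} (h : IsDer k D)
    {a : MultiVec 𝒜} (ha : a ∈ totalPart 𝒜 i) : IsDer (i + k) (LinearMap.mulLeft ℝ a ∘ₗ D) := by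
  intro j s hs t
  simp only [LinearMap.comp_apply, LinearMap.mulLeft_apply, h j s hs t, mul_add, mul_smul_comm,
    ← mul_assoc]
  rw [totalPart_comm ha hs, smul_mul_assoc, smul_smul, add_mul, zpow_add₀ (by norm_num), mul_comm]

/-- Values on generators that extend to a derivation of degree `k`. -/
structure DerData (k : ℤ) (δ : Gen 𝒜 → MultiVec 𝒜) : Prop where
  fn_add : ∀ (i : ℤ) (f g : 𝒜 i), δ (.fn i (f + g)) = δ (.fn i f) + δ (.fn i g)
  fn_smul : ∀ (i : ℤ) (r : ℝ) (f : 𝒜 i), δ (.fn i (r • f)) = r • δ (.fn i f)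
  fn_one : δ (.fn 0 ⟨1, SetLike.one_mem_graded 𝒜⟩) = 0
  fn_mul : ∀ (i j : ℤ) (f : 𝒜 i) (g : 𝒜 j), δ (.fn (i + j) (mulFn f g)) =
    δ (.fn i f) * ofFn 𝒜 g + (-1 : ℝ) ^ (k * i) • (ofFn 𝒜 f * δ (.fn j g))
  vec_add : ∀ (i : ℤ) (X Y : vectorFields 𝒜 i), δ (.vec i (X + Y)) = δ (.vec i X) + δ (.vec i Y)
  vec_smul : ∀ (i : ℤ) (r : ℝ) (X : vectorFields 𝒜 i), δ (.vec i (r • X)) = r • δ (.vec i X)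
  fn_smul_vec : ∀ (i j : ℤ) (f : 𝒜 i) (X : vectorFields 𝒜 j), δ (.vec (i + j) (smulVec f X)) =
    δ (.fn i f) * ofVec 𝒜 X + (-1 : ℝ) ^ (k * i) • (ofFn 𝒜 f * δ (.vec j X))
  mem : ∀ g, δ g ∈ totalPart 𝒜 (k + g.totalDeg)

theorem DerData.exists_der {k : ℤ} {δ : Gen 𝒜 → MultiVec 𝒜} (h : DerData k δ) :
    ∃ D : MultiVec 𝒜 →ₗ[ℝ] MultiVec 𝒜, IsDer k D ∧ ∀ g, D (gen g) = δ g := by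
  obtain ⟨Φ, hΦ⟩ := exists_hom (𝒜 := 𝒜) (B := Matrix (Fin 2) (Fin 2) (MultiVec 𝒜))
    (fun g => !![(-1 : ℝ) ^ (k * g.totalDeg) • gen g, δ g; 0, gen g]) (by
      have hz (a b : ℤ) : (-1 : ℝ) ^ (a + b) = (-1) ^ a * (-1) ^ b := zpow_add₀ (by norm_num) a b
      intro x y hxy
      cases hxy with
      | fn_add i f g =>
        ext a b
        fin_cases a <;> fin_cases b <;>
          simp [h.fn_add, ofFn_add, Gen.totalDeg]
      | fn_smul i r f =>
        ext a b
        fin_cases a <;> fin_cases b <;>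
          simp [h.fn_smul, ofFn_smul, Gen.totalDeg, smul_comm r]
      | fn_one =>
        ext a b
        fin_cases a <;> fin_cases b <;>
          simp [h.fn_one, ofFn_one, Gen.totalDeg]
      | fn_mul i j f g =>
        ext a b
        fin_cases a <;> fin_cases b <;>
          simp [h.fn_mul, ofFn_mul, Gen.totalDeg, Matrix.mul_apply, mul_add, hz, smul_smul,
            add_comm, mul_comm]
      | vec_add i f g =>
        ext a b
        fin_cases a <;> fin_cases b <;>
          simp [h.vec_add, ofVec_add, Gen.totalDeg]
      | vec_smul i r f =>
        ext a b
        fin_cases a <;> fin_cases b <;>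
          simp [h.vec_smul, ofVec_smul, Gen.totalDeg, smul_comm r]
      | fn_smul_vec i j f g =>
        ext a b
        fin_cases a <;> fin_cases b <;>
          simp [h.fn_smul_vec, ofVec_smulVec, Gen.totalDeg, Matrix.mul_apply, mul_add, hz,
            smul_smul, add_comm, mul_comm, mul_left_comm]
      | comm g l =>
        have e1 := totalPart_comm (h.mem g) (gen_mem l)
        have e2 := totalPart_comm (h.mem l) (gen_mem g)
        ext a b
        fin_cases a <;> fin_cases b
        · simp [Matrix.mul_apply, gen_comm g l, smul_smul]
          ring_nf
        · simp only [map_mul, map_smul, FreeAlgebra.lift_ι_apply, Matrix.mul_apply,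
            Fin.sum_univ_two, Matrix.smul_apply, Fin.zero_eta, Fin.mk_one, Matrix.cons_val',
            Matrix.cons_val_zero, Matrix.cons_val_one, Matrix.cons_val_fin_one,
            Matrix.of_apply, smul_mul_assoc]
          rw [e1, e2]
          simp only [neg_one_zpow_ite, Int.even_add, Int.even_mul, add_mul, smul_add, smul_smul]
          by_cases hk : Even k <;> by_cases hl : Even l.totalDeg <;>
            by_cases hi : Even g.totalDeg <;> simp [hk, hl, hi] <;> abel
        · simp [Matrix.mul_apply]
        · simp [Matrix.mul_apply, gen_comm g l])
  have h10 : ∀ L : List (Gen 𝒜), Φ (L.map gen).prod 1 0 = 0 := by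
    intro L
    induction L with
    | nil => simp
    | cons g L ih => simp [hΦ, Matrix.mul_apply, ih]
  have h11 : ∀ z, Φ z 1 1 = z := by
    have : (Matrix.entryLinearMap ℝ (MultiVec 𝒜) (1 : Fin 2) (1 : Fin 2)) ∘ₗ Φ.toLinearMap =
        LinearMap.id := by
      refine linearMap_ext_words fun L => ?_
      induction L with
      | nil => simp
      | cons g L ih =>
        simp only [LinearMap.comp_apply, AlgHom.toLinearMap_apply, Matrix.entryLinearMap_apply,
          LinearMap.id_apply] at ih
        simp only [LinearMap.comp_apply, AlgHom.toLinearMap_apply, Matrix.entryLinearMap_apply,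
          LinearMap.id_apply, List.map_cons, List.prod_cons, map_mul, hΦ]
        rw [Matrix.mul_apply, Fin.sum_univ_two, ih]
        simp
    exact fun z => LinearMap.congr_fun this z
  have h00 : ∀ j, ∀ s ∈ totalPart 𝒜 j, Φ s 0 0 = (-1 : ℝ) ^ (k * j) • s := by
    intro j s hs
    induction hs using Submodule.span_induction with
    | zero => simp
    | add x y _ _ hx hy => simp [hx, hy]
    | smul r x _ hx => simp [hx, smul_comm r]
    | mem x hx =>
      obtain ⟨L, rfl, rfl⟩ := hx
      induction L with
      | nil => simp
      | cons g L ih =>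
        simp [hΦ, Matrix.mul_apply, ih, h10, mul_add, zpow_add₀, smul_smul, mul_comm]
  refine ⟨(Matrix.entryLinearMap ℝ (MultiVec 𝒜) (0 : Fin 2) (1 : Fin 2)) ∘ₗ Φ.toLinearMap,
    fun j s hs t => ?_, fun g => by simp [hΦ]⟩
  simp [Matrix.mul_apply, h11, h00 j s hs, add_comm]

/-- The bracket of two generators. -/
def genBracket : Gen 𝒜 → Gen 𝒜 → MultiVec 𝒜
  | .fn _ _, .fn _ _ => 0
  | .vec _ X, .fn _ f => ofFn 𝒜 (applyFn X f)
  | .fn i f, .vec k X => -((-1 : ℝ) ^ ((i - 1) * k) • ofFn 𝒜 (applyFn X f))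
  | .vec _ X, .vec _ Y => ofVec 𝒜 (commutator X Y)

theorem genBracket_antisymm (g h : Gen 𝒜) : genBracket g h =
    -((-1 : ℝ) ^ ((g.totalDeg - 1) * (h.totalDeg - 1)) • genBracket h g) := by
  cases g with
  | fn i f =>
    cases h with
    | fn j f' => simp [genBracket]
    | vec k X => simp [genBracket, Gen.totalDeg]
  | vec k X =>
    cases h with
    | fn j f' =>
      simp only [genBracket, Gen.totalDeg, add_sub_cancel_right, smul_neg, neg_neg, smul_smul]
      rw [mul_comm k, ← mul_zpow]
      simp
    | vec l Y =>
      simp only [genBracket, Gen.totalDeg, add_sub_cancel_right]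
      rw [← neg_smul, ← ofVec_smul]
      refine ofVec_eq (add_comm _ _) _ _ ?_
      simp only [commutator, Submodule.coe_smul, smul_sub, smul_smul, mul_comm l k, neg_mul,
        ← mul_zpow]
      simp [sub_eq_add_neg, add_comm]

theorem genBracket_mem (g h : Gen 𝒜) :
    genBracket g h ∈ totalPart 𝒜 (g.totalDeg - 1 + h.totalDeg) := by
  cases g with
  | fn i f =>
    cases h with
    | fn j f' => simp [genBracket]
    | vec k X =>
      have := gen_mem (Gen.fn _ (applyFn X f))
      simp only [genBracket, Gen.totalDeg] at *
      convert! neg_mem (Submodule.smul_mem _ _ this) using 2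
      ring
  | vec k X =>
    cases h with
    | fn j f =>
      have := gen_mem (Gen.fn _ (applyFn X f))
      simp only [genBracket, Gen.totalDeg] at *
      convert! this using 2
      ring
    | vec l Y =>
      have := gen_mem (Gen.vec _ (commutator X Y))
      simp only [genBracket, Gen.totalDeg] at *
      convert! this using 2
      ring

theorem genBracket_derData (g : Gen 𝒜) : DerData (g.totalDeg - 1) (genBracket g) := by
  cases g with
  | fn i f =>
    refine ⟨?_, ?_, ?_, ?_, ?_, ?_, ?_, genBracket_mem _⟩
    · intros; simp [genBracket]
    · intros; simp [genBracket]
    · simp [genBracket]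
    · intros; simp [genBracket]
    · intro k X Y
      simp only [genBracket]
      rw [← neg_add, ← smul_add, ← ofFn_add]
      rfl
    · intro k r X
      simp only [genBracket]
      rw [smul_neg, smul_comm r, ← ofFn_smul (𝒜 := 𝒜) r]
      rfl
    · intro j k a X
      simp only [genBracket, Gen.totalDeg, zero_mul, zero_add, mul_neg, mul_smul_comm, smul_neg,
        smul_smul]
      rw [← ofFn_mul, mul_add, zpow_add₀ (by norm_num)]
      congr 2
      refine ofFn_eq (by ring) _ _ ?_
      simp [applyFn, smulVec, mulFn]
  | vec k X =>
    refine ⟨?_, ?_, ?_, ?_, ?_, ?_, ?_, genBracket_mem _⟩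
    · intro i f g
      simp only [genBracket]
      rw [← ofFn_add]
      refine ofFn_eq rfl _ _ ?_
      simp [applyFn]
    · intro i r f
      simp only [genBracket]
      rw [← ofFn_smul]
      refine ofFn_eq rfl _ _ ?_
      simp [applyFn]
    · simp only [genBracket]
      rw [← zero_smul ℝ (ofFn 𝒜 (0 : 𝒜 (0 + k))), ← ofFn_smul]
      refine ofFn_eq rfl _ _ ?_
      have := X.2.2 0 1 (SetLike.one_mem_graded 𝒜) 1
      simp at this
      simp [applyFn, this]
    · intro i j f g
      simp only [genBracket, Gen.totalDeg, add_sub_cancel_right]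
      rw [← ofFn_mul, ← ofFn_mul]
      refine ofFn_comb (by ring) (by ring) _ _ _ _ ?_
      simp [applyFn, mulFn, X.2.2 i f.1 f.2 g.1]
    · intro i Y Z
      simp only [genBracket]
      rw [← ofVec_add]
      refine ofVec_eq rfl _ _ ?_
      simp [commutator, LinearMap.comp_add, LinearMap.add_comp]
      abel
    · intro i r Y
      simp only [genBracket]
      rw [← ofVec_smul]
      refine ofVec_eq rfl _ _ ?_
      simp [commutator, LinearMap.comp_smul, LinearMap.smul_comp, smul_sub, smul_comm r]
    · intro i j f Y
      simp only [genBracket, Gen.totalDeg, add_sub_cancel_right]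
      rw [← ofVec_smulVec, ← ofVec_smulVec]
      refine ofVec_comb (by ring) (by ring) _ _ _ _ ?_
      ext g
      simp only [commutator, smulVec, applyFn, LinearMap.sub_apply, LinearMap.smul_apply,
        LinearMap.comp_apply, LinearMap.mulLeft_apply, LinearMap.add_apply,
        X.2.2 i f.1 f.2 (Y.1 g), mul_sub, smul_sub, mul_smul_comm, smul_smul, mul_add,
        ← zpow_add₀ (show (-1 : ℝ) ≠ 0 by norm_num)]
      abel

/-- The derivation `[g, ·]` of a generator `g`. -/
def adGen (g : Gen 𝒜) : MultiVec 𝒜 →ₗ[ℝ] MultiVec 𝒜 := (genBracket_derData g).exists_der.choose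

theorem adGen_isDer (g : Gen 𝒜) : IsDer (g.totalDeg - 1) (adGen g) :=
  (genBracket_derData g).exists_der.choose_spec.1

theorem adGen_gen (g h : Gen 𝒜) : adGen g (gen h) = genBracket g h :=
  (genBracket_derData g).exists_der.choose_spec.2 h

theorem adGen_mem (g : Gen 𝒜) {i : ℤ} {z : MultiVec 𝒜} (hz : z ∈ totalPart 𝒜 i) :
    adGen g z ∈ totalPart 𝒜 (g.totalDeg - 1 + i) :=
  (adGen_isDer g).mem (fun h => by rw [adGen_gen]; exact genBracket_mem g h) hz

theorem adGen_lin {p a b : Gen 𝒜} {r : ℝ} (ha : a.totalDeg = p.totalDeg)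
    (hb : b.totalDeg = p.totalDeg)
    (h : ∀ k δ, DerData k δ → δ p = δ a + r • δ b) : adGen p = adGen a + r • adGen b := by
  refine (adGen_isDer p).ext (.add (ha ▸ adGen_isDer a) (.smul (hb ▸ adGen_isDer b) r)) fun q => ?_
  simp only [LinearMap.add_apply, LinearMap.smul_apply, adGen_gen]
  rw [genBracket_antisymm p, genBracket_antisymm a, genBracket_antisymm b,
    h _ _ (genBracket_derData q), ha, hb, smul_add, neg_add, smul_neg, smul_comm r]

theorem adGen_zero {p : Gen 𝒜} (h : ∀ k δ, DerData k δ → δ p = 0) : adGen p = 0 := by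
  refine (adGen_isDer p).ext (D' := 0) (fun _ _ _ _ => by simp) fun q => ?_
  rw [adGen_gen, genBracket_antisymm, h _ _ (genBracket_derData q)]
  simp

theorem adGen_mul {p a q : Gen 𝒜} (hp : p.totalDeg = a.totalDeg + q.totalDeg)
    (h : ∀ k δ, DerData k δ →
      δ p = δ a * gen q + (-1 : ℝ) ^ (k * a.totalDeg) • (gen a * δ q)) (z : MultiVec 𝒜) :
    adGen p z = gen a * adGen q z +
      (-1 : ℝ) ^ (a.totalDeg * q.totalDeg) • (gen q * adGen a z) := by
  have h1 := (adGen_isDer q).mulLeft (gen_mem a)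
  have h2 := ((adGen_isDer a).mulLeft (gen_mem q)).smul ((-1 : ℝ) ^ (a.totalDeg * q.totalDeg))
  have e1 : a.totalDeg + (q.totalDeg - 1) = p.totalDeg - 1 := by rw [hp]; ring
  have e2 : q.totalDeg + (a.totalDeg - 1) = p.totalDeg - 1 := by rw [hp]; ring
  rw [e1] at h1
  rw [e2] at h2
  have := (adGen_isDer p).ext (h1.add h2) fun l => by
    simp only [LinearMap.add_apply, LinearMap.smul_apply, LinearMap.comp_apply,
      LinearMap.mulLeft_apply, adGen_gen]
    rw [genBracket_antisymm p, genBracket_antisymm a, genBracket_antisymm q,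
      h _ _ (genBracket_derData l), hp, totalPart_comm (genBracket_mem l a) (gen_mem q)]
    simp only [neg_one_zpow_ite, Int.even_add, Int.even_mul, Int.even_sub, smul_add, smul_smul,
      mul_neg, mul_smul_comm, smul_neg]
    by_cases h1 : Even a.totalDeg <;> by_cases h2 : Even q.totalDeg <;>
      by_cases h3 : Even l.totalDeg <;> simp [h1, h2, h3, add_comm]
  exact LinearMap.congr_fun this z

theorem derData_ad {i : ℤ} {z : MultiVec 𝒜} (hz : z ∈ totalPart 𝒜 i) :
    DerData (i - 1) fun g => -((-1 : ℝ) ^ ((i - 1) * (g.totalDeg - 1)) • adGen g z) := by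
  have hmul : ∀ {p a q : Gen 𝒜} (_ : p.totalDeg = a.totalDeg + q.totalDeg)
      (_ : ∀ k δ, DerData k δ →
        δ p = δ a * gen q + (-1 : ℝ) ^ (k * a.totalDeg) • (gen a * δ q)),
      -((-1 : ℝ) ^ ((i - 1) * (p.totalDeg - 1)) • adGen p z) =
        -((-1 : ℝ) ^ ((i - 1) * (a.totalDeg - 1)) • adGen a z) * gen q +
        (-1 : ℝ) ^ ((i - 1) * a.totalDeg) •
          (gen a * -((-1 : ℝ) ^ ((i - 1) * (q.totalDeg - 1)) • adGen q z)) := by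
    intro p a q hp h
    rw [adGen_mul hp h, hp, neg_mul, smul_mul_assoc, totalPart_comm (adGen_mem a hz) (gen_mem q)]
    simp only [neg_one_zpow_ite, Int.even_add, Int.even_mul, Int.even_sub, smul_add, smul_smul,
      mul_neg, mul_smul_comm, smul_neg]
    by_cases h1 : Even a.totalDeg <;> by_cases h2 : Even q.totalDeg <;>
      by_cases h3 : Even i <;> simp [h1, h2, h3, add_comm]
  refine ⟨?_, ?_, ?_, ?_, ?_, ?_, ?_, ?_⟩
  · intro k f g
    rw [adGen_lin (p := .fn k (f + g)) (a := .fn k f) (b := .fn k g) (r := 1) rfl rfl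
      fun l δ h => by rw [h.fn_add, one_smul]]
    simp only [Gen.totalDeg, one_smul, LinearMap.add_apply, smul_add, neg_add]
  · intro k r f
    rw [adGen_lin (p := .fn k (r • f)) (a := .fn k (0 : 𝒜 k)) (b := .fn k f) (r := r) rfl rfl
      fun l δ h => by rw [h.fn_smul, ← zero_smul ℝ (0 : 𝒜 k), h.fn_smul, zero_smul, zero_add]]
    have h0 : adGen (.fn k (0 : 𝒜 k)) = 0 := adGen_zero fun l δ h => by
      rw [← zero_smul ℝ (0 : 𝒜 k), h.fn_smul, zero_smul]
    simp [Gen.totalDeg, h0, smul_comm r]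
  · have h0 : adGen (.fn 0 (⟨1, SetLike.one_mem_graded 𝒜⟩ : 𝒜 0)) = 0 :=
      adGen_zero fun l δ h => h.fn_one
    simp [h0]
  · exact fun j k f g => hmul (p := .fn (j + k) (mulFn f g)) (a := .fn j f) (q := .fn k g) rfl
      fun l δ h => h.fn_mul j k f g
  · intro k f g
    rw [adGen_lin (p := .vec k (f + g)) (a := .vec k f) (b := .vec k g) (r := 1) rfl rfl
      fun l δ h => by rw [h.vec_add, one_smul]]
    simp only [Gen.totalDeg, one_smul, LinearMap.add_apply, smul_add, neg_add]
  · intro k r f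
    rw [adGen_lin (p := .vec k (r • f)) (a := .vec k (0 : vectorFields 𝒜 k)) (b := .vec k f)
      (r := r) rfl rfl fun l δ h => by
        rw [h.vec_smul, ← zero_smul ℝ (0 : vectorFields 𝒜 k), h.vec_smul, zero_smul, zero_add]]
    have h0 : adGen (.vec k (0 : vectorFields 𝒜 k)) = 0 := adGen_zero fun l δ h => by
      rw [← zero_smul ℝ (0 : vectorFields 𝒜 k), h.vec_smul, zero_smul]
    simp [Gen.totalDeg, h0, smul_comm r]
  · exact fun j k f X => hmul (p := .vec (j + k) (smulVec f X)) (a := .fn j f) (q := .vec k X)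
      (add_assoc _ _ _) fun l δ h => h.fn_smul_vec j k f X
  · intro g
    have := adGen_mem g hz
    convert! neg_mem (Submodule.smul_mem _ _ this) using 2
    ring

/-- The derivation `[z, ·]` of a homogeneous multi-vector field `z`. -/
def adHom (i : ℤ) (z : totalPart 𝒜 i) : MultiVec 𝒜 →ₗ[ℝ] MultiVec 𝒜 :=
  (derData_ad z.2).exists_der.choose

theorem adHom_isDer (i : ℤ) (z : totalPart 𝒜 i) : IsDer (i - 1) (adHom i z) :=
  (derData_ad z.2).exists_der.choose_spec.1

theorem adHom_gen (i : ℤ) (z : totalPart 𝒜 i) (g : Gen 𝒜) : adHom i z (gen g) =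
    -((-1 : ℝ) ^ ((i - 1) * (g.totalDeg - 1)) • adGen g z.1) :=
  (derData_ad z.2).exists_der.choose_spec.2 g

/-- `adHom`, as a linear map. -/
def adLin (i : ℤ) : totalPart 𝒜 i →ₗ[ℝ] MultiVec 𝒜 →ₗ[ℝ] MultiVec 𝒜 where
  toFun := adHom i
  map_add' z w := (adHom_isDer i _).ext ((adHom_isDer i z).add (adHom_isDer i w)) fun g => by
    simp only [LinearMap.add_apply, adHom_gen, Submodule.coe_add, map_add, smul_add, neg_add]
  map_smul' r z := (adHom_isDer i _).ext ((adHom_isDer i z).smul r) fun g => by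
    simp only [LinearMap.smul_apply, adHom_gen, Submodule.coe_smul, map_smul, smul_neg,
      smul_comm r, RingHom.id_apply]

/-- The projections of a word onto the components of a grading of the generators. -/
theorem exists_proj {κ : Type} [AddCommMonoid κ] [DecidableEq κ] (d : Gen 𝒜 → κ) (α β : ℤ → κ)
    (hα : ∀ k f, d (.fn k f) = α k) (hβ : ∀ k X, d (.vec k X) = β k) (h0 : α 0 = 0)
    (hαα : ∀ i j, α (i + j) = α i + α j) (hαβ : ∀ i j, β (i + j) = α i + β j) :
    ∃ P : κ → MultiVec 𝒜 →ₗ[ℝ] MultiVec 𝒜, ∀ (L : List (Gen 𝒜)) (i : κ),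
      P i (L.map gen).prod = if (L.map d).sum = i then (L.map gen).prod else 0 := by
  obtain ⟨Φ, hΦ⟩ := exists_hom (𝒜 := 𝒜) (B := AddMonoidAlgebra (MultiVec 𝒜) κ)
    (fun g => AddMonoidAlgebra.single (d g) (gen g)) (by
      intro x y hxy
      cases hxy with
      | fn_add i f g => simp [ofFn_add, hα, AddMonoidAlgebra.single_add]
      | fn_smul i r f => simp [ofFn_smul, hα]
      | fn_one => simp [ofFn_one, hα, h0, AddMonoidAlgebra.one_def]
      | fn_mul i j f g =>
        simp [ofFn_mul, hα, hαα, AddMonoidAlgebra.single_mul_single]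
      | vec_add i f g => simp [ofVec_add, hβ, AddMonoidAlgebra.single_add]
      | vec_smul i r f => simp [ofVec_smul, hβ]
      | fn_smul_vec i j f g =>
        simp [ofVec_smulVec, hα, hβ, hαβ, AddMonoidAlgebra.single_mul_single]
      | comm g l =>
        simp only [map_mul, map_smul, FreeAlgebra.lift_ι_apply, AddMonoidAlgebra.single_mul_single]
        rw [gen_comm, add_comm, AddMonoidAlgebra.smul_single])
  refine ⟨fun i => { toFun := fun z => (Φ z).coeff i
                     map_add' := fun z w => by simp
                     map_smul' := fun r z => by simp }, fun L i => ?_⟩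
  have : Φ (L.map gen).prod = AddMonoidAlgebra.single (L.map d).sum (L.map gen).prod := by
    induction L with
    | nil => simp [AddMonoidAlgebra.one_def]
    | cons g L ih => simp [hΦ, ih, AddMonoidAlgebra.single_mul_single]
  simp [this, Finsupp.single_apply]

theorem totalPart_isInternal : DirectSum.IsInternal (totalPart 𝒜) := by
  obtain ⟨P, hP⟩ := exists_proj (𝒜 := 𝒜) Gen.totalDeg (fun k => k) (fun k => k + 1)
    (fun _ _ => rfl) (fun _ _ => rfl) rfl (fun _ _ => rfl) (fun _ _ => add_assoc _ _ _)
  have hs : ∀ j, ∀ z ∈ totalPart 𝒜 j, ∀ i, P i z = if j = i then z else 0 := by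
    intro j z hz i
    induction hz using Submodule.span_induction with
    | zero => simp
    | add x y _ _ hx hy => rw [map_add, hx, hy]; split_ifs <;> simp
    | smul r x _ hx => rw [map_smul, hx]; split_ifs <;> simp
    | mem x hx =>
      obtain ⟨L, rfl, rfl⟩ := hx
      exact hP L i
  refine ⟨?_, fun z => ?_⟩
  · refine (injective_iff_map_eq_zero _).2 fun x hx => ?_
    have key : ∀ (y : ⨁ i, totalPart 𝒜 i) (i : ℤ),
        P i (DirectSum.coeAddMonoidHom (totalPart 𝒜) y) = (y i : MultiVec 𝒜) := by
      intro y i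
      induction y using DirectSum.induction_on with
      | zero => simp
      | of j z =>
        rw [DirectSum.coeAddMonoidHom_of, hs j _ z.2, DirectSum.coe_of_apply]
        split_ifs <;> simp_all
      | add x y hx hy => simp [hx, hy]
    refine DFinsupp.ext fun i => Subtype.ext ?_
    rw [← key x i, hx]
    simp
  · have : (⊤ : Submodule ℝ (MultiVec 𝒜)) ≤
        LinearMap.range (DirectSum.coeLinearMap (totalPart 𝒜)) := by
      rw [← span_words, Submodule.span_le]
      rintro _ ⟨L, rfl⟩
      exact ⟨DirectSum.lof ℝ ℤ (fun i => totalPart 𝒜 i) _ ⟨_, prod_mem_degPart L⟩, by simp⟩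
    obtain ⟨x, hx⟩ := this (Submodule.mem_top (x := z))
    exact ⟨x, hx⟩

theorem exists_schoutenNijenhuis :
    ∃ br : MultiVec 𝒜 →ₗ[ℝ] MultiVec 𝒜 →ₗ[ℝ] MultiVec 𝒜, IsSchoutenNijenhuis br := by
  let e := LinearEquiv.ofBijective (DirectSum.coeLinearMap (totalPart 𝒜)) totalPart_isInternal
  let br : MultiVec 𝒜 →ₗ[ℝ] MultiVec 𝒜 →ₗ[ℝ] MultiVec 𝒜 :=
    DirectSum.toModule ℝ ℤ _ adLin ∘ₗ e.symm.toLinearMap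
  have hbr : ∀ i (z : MultiVec 𝒜) (hz : z ∈ totalPart 𝒜 i), br z = adHom i ⟨z, hz⟩ := by
    intro i z hz
    have : e.symm z = DirectSum.lof ℝ ℤ (fun i => totalPart 𝒜 i) i ⟨z, hz⟩ := by
      rw [LinearEquiv.symm_apply_eq]
      exact (DirectSum.coeLinearMap_lof (totalPart 𝒜) i ⟨z, hz⟩).symm
    simp only [br, LinearMap.comp_apply, LinearEquiv.coe_coe, this, DirectSum.toModule_lof]
    rfl
  have hgg : ∀ g h : Gen 𝒜, br (gen g) (gen h) = genBracket g h := by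
    intro g h
    rw [hbr _ _ (gen_mem g), adHom_gen, adGen_gen, ← genBracket_antisymm]
  have hg : ∀ g : Gen 𝒜, br (gen g) = adGen g := by
    intro g
    rw [hbr _ _ (gen_mem g)]
    refine (adHom_isDer _ _).ext (adGen_isDer g) fun h => ?_
    rw [← hbr, hgg, adGen_gen]
  have hder : ∀ i (z : MultiVec 𝒜), z ∈ totalPart 𝒜 i → IsDer (i - 1) (br z) := by
    intro i z hz
    rw [hbr i z hz]
    exact adHom_isDer _ _
  have hzg : ∀ i (z : MultiVec 𝒜), z ∈ totalPart 𝒜 i → ∀ g : Gen 𝒜,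
      br z (gen g) = -((-1 : ℝ) ^ ((i - 1) * (g.totalDeg - 1)) • br (gen g) z) := by
    intro i z hz g
    rw [hbr i z hz, adHom_gen, hg]
  have hmem : ∀ i (z : MultiVec 𝒜), z ∈ totalPart 𝒜 i → ∀ j (w : MultiVec 𝒜),
      w ∈ totalPart 𝒜 j → br z w ∈ totalPart 𝒜 (i - 1 + j) := by
    intro i z hz j w hw
    refine (hder i z hz).mem (fun g => ?_) hw
    rw [hzg i z hz, hg]
    convert! neg_mem (Submodule.smul_mem _ _ (adGen_mem g hz)) using 2
    ring
  have hmul : ∀ i (z : MultiVec 𝒜), z ∈ totalPart 𝒜 i → ∀ j (w : MultiVec 𝒜),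
      w ∈ totalPart 𝒜 j → ∀ x, br (z * w) x = z * br w x + (-1 : ℝ) ^ (i * j) • (w * br z x) := by
    intro i z hz j w hw x
    have h1 := (hder j w hw).mulLeft hz
    have h2 := ((hder i z hz).mulLeft hw).smul ((-1 : ℝ) ^ (i * j))
    rw [show i + (j - 1) = i + j - 1 by ring] at h1
    rw [show j + (i - 1) = i + j - 1 by ring] at h2
    refine LinearMap.congr_fun ((hder _ _ (mul_mem_totalPart hz hw)).ext (h1.add h2) fun g => ?_) x
    simp only [LinearMap.add_apply, LinearMap.smul_apply, LinearMap.comp_apply,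
      LinearMap.mulLeft_apply]
    rw [hzg _ _ (mul_mem_totalPart hz hw), hzg i z hz, hzg j w hw, hder _ _ (gen_mem g) _ _ hz,
      totalPart_comm (hmem _ _ (gen_mem g) _ _ hz) hw]
    simp only [neg_one_zpow_ite, Int.even_add, Int.even_mul, Int.even_sub, smul_add, smul_smul,
      mul_neg, mul_smul_comm, smul_neg]
    by_cases h1 : Even i <;> by_cases h2 : Even j <;>
      by_cases h3 : Even g.totalDeg <;> simp [h1, h2, h3, add_comm]
  refine ⟨br, fun f g => hgg _ _, fun X f => hgg _ _, fun X Y => hgg _ _, ?_,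
    fun hz hw t => hder _ _ hz _ _ hw t⟩
  intro i j z w hz hw
  induction hw using Submodule.span_induction with
  | zero => simp
  | add x y _ _ hx hy => simp only [map_add, hx, hy, LinearMap.add_apply, smul_add, neg_add]
  | smul r x _ hx => simp only [map_smul, hx, LinearMap.smul_apply, smul_neg, smul_comm r]
  | mem x hx =>
    obtain ⟨L, rfl, rfl⟩ := hx
    induction L with
    | nil =>
      have h1 : br (1 : MultiVec 𝒜) = 0 := by
        have hd := hder _ _ (one_mem_degPart : (1 : MultiVec 𝒜) ∈ totalPart 𝒜 0)
        have h0 : IsDer (0 - 1) (0 : MultiVec 𝒜 →ₗ[ℝ] MultiVec 𝒜) := by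
          intro _ _ _ _
          simp
        refine hd.ext h0 fun g => ?_
        rw [hzg _ _ one_mem_degPart, (hder _ _ (gen_mem g)).map_one]
        simp
      simp [h1, (hder _ _ hz).map_one]
    | cons g L ih =>
      simp only [List.map_cons, List.prod_cons, List.sum_cons]
      have hL : (L.map gen).prod ∈ totalPart 𝒜 (L.map Gen.totalDeg).sum := prod_mem_degPart L
      rw [hder _ _ hz _ _ (gen_mem g), hmul _ _ (gen_mem g) _ _ hL, ih, hzg _ _ hz,
        neg_mul, smul_mul_assoc, totalPart_comm (hmem _ _ (gen_mem g) _ _ hz) hL]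
      generalize (L.map Gen.totalDeg).sum = l
      simp only [neg_one_zpow_ite, Int.even_add, Int.even_mul, Int.even_sub, smul_add, smul_smul,
        mul_neg, mul_smul_comm, smul_neg]
      by_cases h1 : Even i <;> by_cases h2 : Even l <;>
        by_cases h3 : Even g.totalDeg <;> simp [h1, h2, h3]

theorem IsSchoutenNijenhuis.unique {br br' : MultiVec 𝒜 →ₗ[ℝ] MultiVec 𝒜 →ₗ[ℝ] MultiVec 𝒜}
    (h : IsSchoutenNijenhuis br) (h' : IsSchoutenNijenhuis br') : br = br' := by
  have hgg : ∀ g l : Gen 𝒜, br (gen g) (gen l) = br' (gen g) (gen l) := by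
    intro g l
    cases g with
    | fn i f =>
      cases l with
      | fn j f' => rw [h.fn_fn, h'.fn_fn]
      | vec k X =>
        rw [h.antisymm (gen_mem _) (gen_mem _), h'.antisymm (gen_mem _) (gen_mem _), h.vec_fn,
          h'.vec_fn]
    | vec k X =>
      cases l with
      | fn j f => rw [h.vec_fn, h'.vec_fn]
      | vec l Y => rw [h.vec_vec, h'.vec_vec]
  have hg : ∀ g : Gen 𝒜, br (gen g) = br' (gen g) := fun g =>
    IsDer.ext (k := g.totalDeg - 1) (fun j s hs t => h.leibniz (gen_mem g) hs t)
      (fun j s hs t => h'.leibniz (gen_mem g) hs t) (hgg g)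
  refine linearMap_ext_words fun L => ?_
  have hL : (L.map gen).prod ∈ totalPart 𝒜 (L.map Gen.totalDeg).sum := prod_mem_degPart L
  refine IsDer.ext (k := (L.map Gen.totalDeg).sum - 1) (fun j s hs t => h.leibniz hL hs t)
    (fun j s hs t => h'.leibniz hL hs t) fun g => ?_
  rw [h.antisymm hL (gen_mem g), h'.antisymm hL (gen_mem g), hg]

variable (𝒜) in
/-- The Schouten-Nijenhuis bracket of multi-vector fields. -/
def schouten : MultiVec 𝒜 →ₗ[ℝ] MultiVec 𝒜 →ₗ[ℝ] MultiVec 𝒜 :=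
  (exists_schoutenNijenhuis (𝒜 := 𝒜)).choose

theorem schouten_spec : IsSchoutenNijenhuis (schouten 𝒜) :=
  (exists_schoutenNijenhuis (𝒜 := 𝒜)).choose_spec

end MultiVector

/-! ### Graded manifolds and their functions -/

section GradedSym

variable {n : ℕ} (W : Fin n → Type v) [∀ i, AddCommGroup (W i)] [∀ i, Module ℝ (W i)]

/-- The degree of the `i`-th component of a graded vector space in degrees `1, …, n`. -/
def codeg (i : Fin n) : ℤ := (i : ℤ) + 1

/-- Graded commutativity: `v ⊗ w ∼ (-1)^{|v||w|} w ⊗ v` for homogeneous `v`, `w`. -/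
inductive SymRel : TensorAlgebra ℝ (⨁ i, W i) → TensorAlgebra ℝ (⨁ i, W i) → Prop
  | swap (i j : Fin n) (v : W i) (w : W j) :
      SymRel (.ι ℝ (DirectSum.lof ℝ (Fin n) W i v) * .ι ℝ (DirectSum.lof ℝ (Fin n) W j w))
        ((-1 : ℝ) ^ (codeg i * codeg j) •
          (.ι ℝ (DirectSum.lof ℝ (Fin n) W j w) * .ι ℝ (DirectSum.lof ℝ (Fin n) W i v)))

/-- The symmetric algebra of the graded vector space whose component of degree `i + 1` is `W i`. -/
def GradedSym : Type v := RingQuot (SymRel W)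

instance : Ring (GradedSym W) := inferInstanceAs (Ring (RingQuot (SymRel W)))
instance : Algebra ℝ (GradedSym W) := inferInstanceAs (Algebra ℝ (RingQuot (SymRel W)))

variable {W} in
/-- A homogeneous vector, seen in the symmetric algebra. -/
def symGen (p : Σ i, W i) : GradedSym W :=
  RingQuot.mkAlgHom ℝ (SymRel W) (.ι ℝ (DirectSum.lof ℝ (Fin n) W p.1 p.2))

/-- The component of degree `k` of the symmetric algebra. -/
def symPart (k : ℤ) : Submodule ℝ (GradedSym W) := degPart symGen (fun p => codeg p.1) k

theorem symGen_comm (p q : Σ i, W i) :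
    symGen p * symGen q = (-1 : ℝ) ^ (codeg p.1 * codeg q.1) • (symGen q * symGen p) := by
  have := RingQuot.mkAlgHom_rel ℝ (SymRel.swap p.1 q.1 p.2 q.2)
  rwa [map_smul, map_mul, map_mul] at this

end GradedSym

open Bundle

/-- A graded manifold concentrated in degrees `-n, …, -1` over a smooth manifold `M`: smooth vector
bundles of finite rank, `Fiber i` being the one of degree `-(i + 1)`. -/
structure GradedManifold (m n : ℕ) (M : Type u) [TopologicalSpace M]
    [ChartedSpace (EuclideanSpace ℝ (Fin m)) M] where
  Model : Fin n → Type v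
  Fiber : Fin n → M → Type v
  [normedModel : ∀ i, NormedAddCommGroup (Model i)]
  [normedSpaceModel : ∀ i, NormedSpace ℝ (Model i)]
  [finiteDimensional : ∀ i, FiniteDimensional ℝ (Model i)]
  [addCommGroup : ∀ i x, AddCommGroup (Fiber i x)]
  [module : ∀ i x, Module ℝ (Fiber i x)]
  [topology : ∀ i x, TopologicalSpace (Fiber i x)]
  [topologicalAddGroup : ∀ i x, IsTopologicalAddGroup (Fiber i x)]
  [continuousSMul : ∀ i x, ContinuousSMul ℝ (Fiber i x)]
  [totalTopology : ∀ i, TopologicalSpace (TotalSpace (Model i) (Fiber i))]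
  [fiberBundle : ∀ i, FiberBundle (Model i) (Fiber i)]
  [vectorBundle : ∀ i, VectorBundle ℝ (Model i) (Fiber i)]
  [smooth : ∀ i, ContMDiffVectorBundle ∞ (Model i) (Fiber i) (𝓡 m)]

attribute [instance] GradedManifold.normedModel GradedManifold.normedSpaceModel
  GradedManifold.finiteDimensional GradedManifold.addCommGroup GradedManifold.module
  GradedManifold.topology GradedManifold.topologicalAddGroup GradedManifold.continuousSMul
  GradedManifold.totalTopology GradedManifold.fiberBundle GradedManifold.vectorBundle
  GradedManifold.smooth

namespace GradedManifold

variable {m n : ℕ} {M : Type u} [TopologicalSpace M] [ChartedSpace (EuclideanSpace ℝ (Fin m)) M]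
  (𝓔 : GradedManifold.{u, v} m n M)

/-- The fiber at `x` of the component of degree `i + 1` of the dual graded bundle. -/
abbrev DualFiber (x : M) (i : Fin n) : Type v := 𝓔.Fiber i x →L[ℝ] ℝ

/-- Smooth sections of the component of degree `i + 1` of the dual graded bundle. -/
def IsSmoothDualSection (i : Fin n) (s : ∀ x, 𝓔.DualFiber x i) : Prop :=
  ContMDiff (𝓡 m) ((𝓡 m).prod 𝓘(ℝ, 𝓔.Model i →L[ℝ] ℝ)) ∞
    (fun x => TotalSpace.mk' (𝓔.Model i →L[ℝ] ℝ)
      (E := fun x => 𝓔.Fiber i x →L[ℝ] Bundle.Trivial M ℝ x) x (s x))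

/-- Arbitrary sections of the symmetric algebra bundle of the dual. -/
abbrev RoughSection : Type (max u v) := ∀ x : M, GradedSym (𝓔.DualFiber x)

/-- Sums of products of smooth functions on the base and smooth sections of the dual bundles. -/
def polynomialSections : Subalgebra ℝ 𝓔.RoughSection :=
  Algebra.adjoin ℝ
    ({σ | ∃ f : M → ℝ, ContMDiff (𝓡 m) 𝓘(ℝ, ℝ) ∞ f ∧
        σ = fun x => algebraMap ℝ (GradedSym (𝓔.DualFiber x)) (f x)} ∪
      {σ | ∃ (i : Fin n) (s : ∀ x, 𝓔.DualFiber x i), 𝓔.IsSmoothDualSection i s ∧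
        σ = fun x => symGen ⟨i, s x⟩})

/-- A section of the symmetric algebra bundle is smooth if locally it is a sum of products of
smooth functions on the base and smooth sections of the dual bundles. -/
def IsSmoothSection (σ : 𝓔.RoughSection) : Prop :=
  ∀ x₀ : M, ∃ τ ∈ 𝓔.polynomialSections, ∀ᶠ x in 𝓝 x₀, σ x = τ x

theorem IsSmoothSection.add {σ τ : 𝓔.RoughSection} (h : 𝓔.IsSmoothSection σ)
    (h' : 𝓔.IsSmoothSection τ) : 𝓔.IsSmoothSection (σ + τ) := fun x₀ => by
  obtain ⟨a, ha, ha'⟩ := h x₀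
  obtain ⟨b, hb, hb'⟩ := h' x₀
  refine ⟨a + b, add_mem ha hb, ?_⟩
  filter_upwards [ha', hb'] with x h1 h2
  simp [h1, h2]

theorem IsSmoothSection.mul {σ τ : 𝓔.RoughSection} (h : 𝓔.IsSmoothSection σ)
    (h' : 𝓔.IsSmoothSection τ) : 𝓔.IsSmoothSection (σ * τ) := fun x₀ => by
  obtain ⟨a, ha, ha'⟩ := h x₀
  obtain ⟨b, hb, hb'⟩ := h' x₀
  refine ⟨a * b, mul_mem ha hb, ?_⟩
  filter_upwards [ha', hb'] with x h1 h2
  simp [h1, h2]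

/-- Smooth sections of degree `k` of the symmetric algebra bundle of the dual. -/
def homogeneousSections (k : ℤ) : Submodule ℝ 𝓔.RoughSection where
  carrier := {σ | (∀ x, σ x ∈ symPart (𝓔.DualFiber x) k) ∧ 𝓔.IsSmoothSection σ}
  zero_mem' := ⟨fun x => zero_mem _, fun _ => ⟨0, zero_mem _, by simp⟩⟩
  add_mem' h h' := ⟨fun x => add_mem (h.1 x) (h'.1 x), h.2.add 𝓔 h'.2⟩
  smul_mem' r σ h := ⟨fun x => Submodule.smul_mem _ _ (h.1 x), fun x₀ => by
    obtain ⟨a, ha, ha'⟩ := h.2 x₀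
    refine ⟨r • a, Subalgebra.smul_mem _ ha r, ?_⟩
    filter_upwards [ha'] with x h1
    simp [h1]⟩

/-- The algebra `C^∞(𝓔)` of smooth functions on `𝓔`: finite sums of homogeneous smooth sections of
the symmetric algebra bundle of the dual. -/
def functions : Subalgebra ℝ 𝓔.RoughSection :=
  Algebra.adjoin ℝ (⋃ k : ℤ, (𝓔.homogeneousSections k : Set 𝓔.RoughSection))

/-- The type of smooth functions on `𝓔`. -/
def Fn : Type (max u v) := 𝓔.functions

instance : Ring 𝓔.Fn := inferInstanceAs (Ring 𝓔.functions)
instance : Algebra ℝ 𝓔.Fn := inferInstanceAs (Algebra ℝ 𝓔.functions)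

/-- Smooth functions of degree `k` on `𝓔`. -/
def fnPart (k : ℤ) : Submodule ℝ 𝓔.Fn :=
  (𝓔.homogeneousSections k).comap 𝓔.functions.val.toLinearMap

instance : IsGradedComm 𝓔.fnPart where
  one_mem := ⟨fun _ => one_mem_degPart, fun _ => ⟨1, one_mem _, .of_forall fun _ => rfl⟩⟩
  mul_mem _ _ _ _ h h' := ⟨fun x => mul_mem_degPart (h.1 x) (h'.1 x), h.2.mul 𝓔 h'.2⟩
  comm h h' := Subtype.ext <| funext fun x => degPart_comm (symGen_comm _) (h.1 x) (h'.1 x)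

/-- The algebra `𝔛(𝓔)` of multi-vector fields on `𝓔`. -/
abbrev MultiVectorField : Type (max u v) := MultiVec 𝓔.fnPart

/-- The Schouten-Nijenhuis bracket on `𝔛(𝓔)`. -/
abbrev bracket : 𝓔.MultiVectorField →ₗ[ℝ] 𝓔.MultiVectorField →ₗ[ℝ] 𝓔.MultiVectorField :=
  schouten 𝓔.fnPart

/-- Multi-vector fields `Z` on `𝓔` with `‖Z‖ = k`. -/
abbrev shifted (k : ℤ) : Submodule ℝ 𝓔.MultiVectorField := shiftedPart 𝓔.fnPart k

/-- The space `𝔛¹(𝓔)` of multi-vector fields of multiplicity `1`. -/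
abbrev univectors : Submodule ℝ 𝓔.MultiVectorField := multPart 𝓔.fnPart 1

/-- The grading of `𝔛¹(𝓔)` by the shifted degree. -/
abbrev shiftedUnivectors (k : ℤ) : Submodule ℝ 𝓔.univectors :=
  (𝓔.shifted k).comap 𝓔.univectors.subtype

end GradedManifold

/-! ### Blended differential graded Lie algebras -/

section DGLA

variable {V : Type*} [AddCommGroup V] [Module ℝ V] (𝒱 : ℤ → Submodule ℝ V)
  (br : V →ₗ[ℝ] V →ₗ[ℝ] V)

/-- Graded Lie algebras. -/
structure IsGradedLieAlgebra : Prop where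
  isInternal : DirectSum.IsInternal 𝒱
  degree : ∀ {i j : ℤ} {a b : V}, a ∈ 𝒱 i → b ∈ 𝒱 j → br a b ∈ 𝒱 (i + j)
  antisymm : ∀ {i j : ℤ} {a b : V}, a ∈ 𝒱 i → b ∈ 𝒱 j → br b a = -((-1 : ℝ) ^ (i * j) • br a b)
  jacobi : ∀ {i j k : ℤ} {a b c : V}, a ∈ 𝒱 i → b ∈ 𝒱 j → c ∈ 𝒱 k →
    br a (br b c) = br (br a b) c + (-1 : ℝ) ^ (i * j) • br b (br a c)

/-- Derivations of degree `n` of a graded Lie algebra. -/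
structure IsLieDerivation (n : ℤ) (d : V →ₗ[ℝ] V) : Prop where
  degree : ∀ {i : ℤ} {a : V}, a ∈ 𝒱 i → d a ∈ 𝒱 (i + n)
  leibniz : ∀ {i j : ℤ} {a b : V}, a ∈ 𝒱 i → b ∈ 𝒱 j →
    d (br a b) = br (d a) b + (-1 : ℝ) ^ (n * i) • br a (d b)

/-- Blended differential graded Lie algebras `(V, [·,·], d⁺, d⁻)`. -/
structure IsBlendedDGLA (dp dm : V →ₗ[ℝ] V) : Prop where
  gradedLie : IsGradedLieAlgebra 𝒱 br
  derivation_pos : IsLieDerivation 𝒱 br 1 dp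
  derivation_neg : IsLieDerivation 𝒱 br (-1) dm
  sq_pos : dp ∘ₗ dp = 0
  sq_neg : dm ∘ₗ dm = 0
  compatible : dp ∘ₗ dm + dm ∘ₗ dp = 0

/-- Maurer-Cartan elements `v = v⁺ + v⁻` with `v⁺ ∈ V₁` and `v⁻ ∈ V₋₁`. -/
def IsMaurerCartan (dp dm : V →ₗ[ℝ] V) (v : V) : Prop :=
  (∃ vp ∈ 𝒱 1, ∃ vm ∈ 𝒱 (-1), v = vp + vm) ∧ (dp + dm) v + (1 / 2 : ℝ) • br v v = 0

variable {br} in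
/-- The restriction of a bilinear operation to a subspace closed under it. -/
def restrictBr (N : Submodule ℝ V) (h : ∀ a ∈ N, ∀ b ∈ N, br a b ∈ N) : N →ₗ[ℝ] N →ₗ[ℝ] N :=
  LinearMap.mk₂ ℝ (fun a b => ⟨br a b, h a a.2 b b.2⟩)
    (fun _ _ _ => Subtype.ext (by simp)) (fun _ _ _ => Subtype.ext (by simp))
    (fun _ _ _ => Subtype.ext (by simp)) (fun _ _ _ => Subtype.ext (by simp))

end DGLA

/-! ### Blended homological vector fields -/

section Blended

variable {A : Type u} [Ring A] [Algebra ℝ A] {𝒜 : ℤ → Submodule ℝ A} [IsGradedComm 𝒜]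

/-- A blended `Q`-structure: `Q⁺` and `Q⁻` are homological of shifted degrees `1` and `-1`, and
compatible. -/
structure IsBlendedPair (Qp Qm : MultiVec 𝒜) : Prop where
  pos_mem : Qp ∈ shiftedPart 𝒜 1
  neg_mem : Qm ∈ shiftedPart 𝒜 (-1)
  pos_homological : schouten 𝒜 Qp Qp = 0
  neg_homological : schouten 𝒜 Qm Qm = 0
  compatible : schouten 𝒜 Qp Qm = 0

/-- Blended homological vector fields `Q = Q⁺ + Q⁻`. -/
def IsBlendedHomological (Q : MultiVec 𝒜) : Prop :=
  ∃ Qp Qm : MultiVec 𝒜, IsBlendedPair Qp Qm ∧ Q = Qp + Qm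

/-- Deformations of `Q`: elements of `𝔛₁ ⊕ 𝔛₋₁` that added to `Q` give a blended homological
vector field again. -/
def IsDeformation (Q Qt : MultiVec 𝒜) : Prop :=
  (∃ Qtp ∈ shiftedPart 𝒜 1, ∃ Qtm ∈ shiftedPart 𝒜 (-1), Qt = Qtp + Qtm) ∧
    IsBlendedHomological (Q + Qt)

end Blended

end BlendedQ

end

/-! Everything takes place over a graded commutative algebra of functions, and rests on the graded
Jacobi identity and on two compatible gradings.

For homogeneous `a` and `b`, the graded commutator of `[a, ·]` and `[b, ·]` and the operator `[[a,
b], ·]` are derivations of the wedge product of the same degree. The Jacobi identity says that they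
coincide, so it suffices to check it with a generator in the third slot (`Jacobi.of_gen`).
Antisymmetry makes the identity invariant under cyclic rotation (`Jacobi.rotate`), which brings
every slot into third position. Only functions and vector fields remain, where the identity is
either trivial or a property of commutators of operators (`jacobi_gen`, `schouten_jacobi`).

The axioms on `d⁺` and `d⁻` are then formal: each is an inner derivation, its square vanishes
because the element is odd and has bracket zero with itself, and the two anticommute because `[Q⁺,
Q⁻] = 0`. For elements of degrees `1` and `-1`, the three equations of a blended structure are the
components of `[Q, Q] = 0` in degrees `2`, `0` and `-2` (`isBlendedPair_iff`). Expanding the square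
of `Q + Q̃` gives twice the Maurer–Cartan expression of `Q̃`.

For multiplicity one, the bracket lowers the sum of the multiplicities by one
(`schouten_mem_multPart`). A word in the generators is homogeneous for both gradings, so the
projections onto shifted degrees preserve multiplicity (`exists_shiftedPart_proj`). Hence `Q⁺` and
`Q⁻` have multiplicity one if `Q` does, and the whole structure restricts. -/

namespace BlendedQ

/-! ### Gradings detected by projections -/

section Projections

variable {V : Type*} [AddCommGroup V] [Module ℝ V] {𝒱 : ℤ → Submodule ℝ V}

/-- A family of operators which restrict to the identity or zero on each `𝒱 j`. -/
def IsProjFamily (𝒱 : ℤ → Submodule ℝ V) (P : ℤ → V →ₗ[ℝ] V) : Prop :=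
  ∀ j, ∀ z ∈ 𝒱 j, ∀ i, P i z = if j = i then z else 0

/-- `P i` vanishes on every summand other than `𝒱 i` and is the identity on `𝒱 i`, so `𝒱 i` meets
the span of the others only in zero. -/
theorem IsProjFamily.isInternal {P : ℤ → V →ₗ[ℝ] V} (hP : IsProjFamily 𝒱 P)
    (htop : ⨆ i, 𝒱 i = ⊤) : DirectSum.IsInternal 𝒱 := by
  refine DirectSum.isInternal_submodule_of_iSupIndep_of_iSup_eq_top (fun i => ?_) htop
  rw [Submodule.disjoint_def]
  intro x hx hx'
  have hle : ⨆ j, ⨆ (_ : j ≠ i), 𝒱 j ≤ LinearMap.ker (P i) :=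
    iSup₂_le fun j hj z hz => by simp [hP j z hz i, hj]
  have h0 : P i x = 0 := hle hx'
  rwa [hP i x hx i, if_pos rfl] at h0

theorem IsProjFamily.eq_of_add_eq {P : ℤ → V →ₗ[ℝ] V} (hP : IsProjFamily 𝒱 P) {i j : ℤ}
    (hij : i ≠ j) {a a' b b' : V} (ha : a ∈ 𝒱 i) (ha' : a' ∈ 𝒱 i) (hb : b ∈ 𝒱 j)
    (hb' : b' ∈ 𝒱 j) (h : a + b = a' + b') : a = a' ∧ b = b' := by
  have h1 := congrArg (P i) h
  simp only [map_add, hP i _ ha, hP i _ ha', hP j _ hb, hP j _ hb', if_true, if_neg hij.symm,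
    add_zero] at h1
  exact ⟨h1, by rwa [h1, add_right_inj] at h⟩

end Projections

/-! ### Values, antisymmetry and degree of the bracket in the shifted grading -/

section MultiVector

variable {A : Type*} [Ring A] [Algebra ℝ A] {𝒜 : ℤ → Submodule ℝ A} [IsGradedComm 𝒜]

/-- `schouten` is obtained by choice, so its values are read off from `schouten_spec`; a function
against a vector field needs antisymmetry. -/
theorem schouten_gen (g h : Gen 𝒜) : schouten 𝒜 (gen g) (gen h) = genBracket g h := by
  cases g with
  | fn i f =>
    cases h with
    | fn j f' => exact schouten_spec.fn_fn f f'
    | vec k X =>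
      rw [schouten_spec.antisymm (gen_mem _) (gen_mem _), schouten_spec.vec_fn]
      simp [genBracket, Gen.totalDeg]
  | vec k X =>
    cases h with
    | fn j f => exact schouten_spec.vec_fn X f
    | vec l Y => exact schouten_spec.vec_vec X Y

theorem schouten_isDer {i : ℤ} {z : MultiVec 𝒜} (hz : z ∈ shiftedPart 𝒜 i) :
    IsDer i (schouten 𝒜 z) := fun j s hs t => by
  simpa using schouten_spec.leibniz hz hs t

theorem schouten_antisymm {i j : ℤ} {a b : MultiVec 𝒜} (ha : a ∈ shiftedPart 𝒜 i)
    (hb : b ∈ shiftedPart 𝒜 j) : schouten 𝒜 b a = -((-1 : ℝ) ^ (i * j) • schouten 𝒜 a b) := by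
  simpa [mul_comm] using schouten_spec.antisymm hb ha

theorem gen_mem_shiftedPart (g : Gen 𝒜) : gen g ∈ shiftedPart 𝒜 (g.totalDeg - 1) := by
  simpa [shiftedPart] using gen_mem g

theorem schouten_gen_mem_totalPart (g : Gen 𝒜) {j : ℤ} {z : MultiVec 𝒜}
    (hz : z ∈ totalPart 𝒜 j) : schouten 𝒜 (gen g) z ∈ totalPart 𝒜 (g.totalDeg - 1 + j) :=
  (schouten_isDer (gen_mem_shiftedPart g)).mem
    (fun h => by rw [schouten_gen]; exact genBracket_mem g h) hz

/-- `IsDer.mem` reduces to a generator on the right. Antisymmetry moves it to the left, where the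
same reduction ends with the bracket of two generators. -/
theorem schouten_mem_shiftedPart {i j : ℤ} {a b : MultiVec 𝒜} (ha : a ∈ shiftedPart 𝒜 i)
    (hb : b ∈ shiftedPart 𝒜 j) : schouten 𝒜 a b ∈ shiftedPart 𝒜 (i + j) := by
  have := (schouten_isDer ha).mem (fun g => ?_) hb
  · rwa [← add_assoc] at this
  · rw [schouten_antisymm (gen_mem_shiftedPart g) ha]
    convert! neg_mem (Submodule.smul_mem _ _ (schouten_gen_mem_totalPart g ha)) using 2
    ring

/-! ### The Jacobi identity -/

/-- The mixed terms `D s * E t` and `E s * D t` cancel. The degree hypotheses allow the Leibniz rule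
to be applied a second time, to `E s * t` and `D s * t`. -/
theorem IsDer.comp_sub {i j : ℤ} {D E : MultiVec 𝒜 →ₗ[ℝ] MultiVec 𝒜} (hD : IsDer i D)
    (hE : IsDer j E) (hDm : ∀ k, ∀ z ∈ totalPart 𝒜 k, D z ∈ totalPart 𝒜 (i + k))
    (hEm : ∀ k, ∀ z ∈ totalPart 𝒜 k, E z ∈ totalPart 𝒜 (j + k)) :
    IsDer (i + j) (D ∘ₗ E - (-1 : ℝ) ^ (i * j) • (E ∘ₗ D)) := by
  intro k s hs t
  simp only [LinearMap.sub_apply, LinearMap.smul_apply, LinearMap.comp_apply, hD k s hs,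
    hE k s hs, map_add, map_smul, hD _ _ (hEm k s hs), hE _ _ (hDm k s hs)]
  simp only [neg_one_zpow_ite, mul_add, add_mul, Int.even_add, Int.even_mul, sub_mul,
    smul_mul_assoc, mul_sub, smul_add, smul_sub, mul_smul_comm, smul_smul]
  -- All signs depend only on the parities of the three degrees.
  by_cases hi : Even i <;> by_cases hj : Even j <;> by_cases hk : Even k <;>
    simp [hi, hj, hk] <;> abel

/-- The graded Jacobi identity for elements of shifted degrees `i`, `j` and any third argument. -/
def Jacobi (i j : ℤ) (a b c : MultiVec 𝒜) : Prop :=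
  schouten 𝒜 a (schouten 𝒜 b c) = schouten 𝒜 (schouten 𝒜 a b) c +
    (-1 : ℝ) ^ (i * j) • schouten 𝒜 b (schouten 𝒜 a c)

/-- As a function of `c`, the identity equates two derivations of degree `i + j`, and these are
determined by their values on generators. -/
theorem Jacobi.of_gen {i j : ℤ} {a b : MultiVec 𝒜} (ha : a ∈ shiftedPart 𝒜 i)
    (hb : b ∈ shiftedPart 𝒜 j) (h : ∀ g, Jacobi i j a b (gen g)) (c : MultiVec 𝒜) :
    Jacobi i j a b c := by
  have hm : ∀ {i : ℤ} {a : MultiVec 𝒜}, a ∈ shiftedPart 𝒜 i → ∀ k, ∀ z ∈ totalPart 𝒜 k,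
      schouten 𝒜 a z ∈ totalPart 𝒜 (i + k) := by
    intro i a ha k z hz
    -- Total degree `k` is shifted degree `k - 1`.
    have := schouten_mem_shiftedPart (j := k - 1) ha (by simpa [shiftedPart] using hz)
    rw [shiftedPart] at this
    convert this using 2
    ring
  have key := IsDer.ext
    ((schouten_isDer ha).comp_sub (schouten_isDer hb) (hm ha) (hm hb))
    (schouten_isDer (schouten_mem_shiftedPart ha hb)) fun g => by
      have := h g
      rw [Jacobi] at this
      simp [this]
  have := LinearMap.congr_fun key c
  simp only [LinearMap.sub_apply, LinearMap.smul_apply, LinearMap.comp_apply] at this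
  exact sub_eq_iff_eq_add.1 this

/-- Cyclic symmetry, a consequence of antisymmetry, extends to every slot what is proved for the
third one. -/
theorem Jacobi.rotate {i j k : ℤ} {a b c : MultiVec 𝒜} (ha : a ∈ shiftedPart 𝒜 i)
    (hb : b ∈ shiftedPart 𝒜 j) (hc : c ∈ shiftedPart 𝒜 k) (h : Jacobi i j a b c) :
    Jacobi k i c a b := by
  have h1 := schouten_antisymm (schouten_mem_shiftedPart ha hb) hc
  have h2 := schouten_antisymm hb (schouten_mem_shiftedPart ha hc)
  rw [Jacobi] at h ⊢
  rw [h1, schouten_antisymm ha hc, schouten_antisymm hb hc]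
  simp only [map_neg, map_smul, LinearMap.neg_apply, LinearMap.smul_apply]
  rw [h2, h]
  -- Both sides are now combinations of `[[a, b], c]` and `[b, [a, c]]`; only the signs remain to be
  -- compared.
  simp only [neg_one_zpow_ite, add_mul, mul_add, Int.even_add, Int.even_mul, smul_add, smul_neg,
    smul_smul]
  by_cases hi : Even i <;> by_cases hj : Even j <;> by_cases hk : Even k <;>
    simp [hi, hj, hk]

theorem schouten_ofFn_ofFn {i j : ℤ} (f : 𝒜 i) (g : 𝒜 j) :
    schouten 𝒜 (ofFn 𝒜 f) (ofFn 𝒜 g) = 0 := schouten_spec.fn_fn f g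

/-- `X f` and `X g` are again functions, and functions bracket to zero, so every term vanishes. -/
theorem jacobi_vec_fn_fn {k i j : ℤ} (X : vectorFields 𝒜 k) (f : 𝒜 i) (g : 𝒜 j) :
    Jacobi k (i - 1) (ofVec 𝒜 X) (ofFn 𝒜 f) (ofFn 𝒜 g) := by
  rw [Jacobi, schouten_spec.vec_fn, schouten_spec.vec_fn]
  simp only [schouten_ofFn_ofFn, map_zero, smul_zero, add_zero]

/-- This is the definition of the commutator evaluated at `f`. The three terms carry differently
associated degrees, which `ofFn_comb` reconciles by comparing underlying functions. -/
theorem jacobi_vec_vec_fn {k l i : ℤ} (X : vectorFields 𝒜 k) (Y : vectorFields 𝒜 l) (f : 𝒜 i) :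
    Jacobi k l (ofVec 𝒜 X) (ofVec 𝒜 Y) (ofFn 𝒜 f) := by
  simp only [Jacobi, schouten_spec.vec_fn, schouten_spec.vec_vec]
  refine ofFn_comb (by ring) (by ring) _ _ _ _ ?_
  simp [applyFn, commutator]

/-- The Jacobi identity for graded commutators in the associative algebra of operators. -/
theorem jacobi_vec_vec_vec {k l p : ℤ} (X : vectorFields 𝒜 k) (Y : vectorFields 𝒜 l)
    (Z : vectorFields 𝒜 p) : Jacobi k l (ofVec 𝒜 X) (ofVec 𝒜 Y) (ofVec 𝒜 Z) := by
  simp only [Jacobi, schouten_spec.vec_vec]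
  refine ofVec_comb (by ring) (by ring) _ _ _ _ ?_
  ext g
  simp only [commutator, LinearMap.sub_apply, LinearMap.smul_apply, LinearMap.comp_apply,
    LinearMap.add_apply, map_sub, map_smul]
  simp only [neg_one_zpow_ite, add_mul, mul_add, Int.even_add, Int.even_mul, smul_sub, smul_smul]
  by_cases hk : Even k <;> by_cases hl : Even l <;> by_cases hp : Even p <;>
    simp [hk, hl, hp] <;> abel

theorem ofVec_mem_shiftedPart {k : ℤ} (X : vectorFields 𝒜 k) : ofVec 𝒜 X ∈ shiftedPart 𝒜 k :=
  gen_mem (Gen.vec k X)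

/-- Apart from three functions, every pattern is a cyclic rotation of one of the three preceding
cases, whose arguments are arbitrary. -/
theorem jacobi_gen (g h l : Gen 𝒜) :
    Jacobi (g.totalDeg - 1) (h.totalDeg - 1) (gen g) (gen h) (gen l) := by
  cases g with
  | fn i f =>
    cases h with
    | fn j f' =>
      cases l with
      | fn k f'' =>
        simp only [Jacobi, schouten_ofFn_ofFn, map_zero, LinearMap.zero_apply, smul_zero, add_zero]
      | vec k X =>
        have := (jacobi_vec_fn_fn X f f').rotate (ofVec_mem_shiftedPart X)
          (gen_mem_shiftedPart (.fn i f)) (gen_mem_shiftedPart (.fn j f'))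
        exact this.rotate (gen_mem_shiftedPart (.fn j f')) (ofVec_mem_shiftedPart X)
          (gen_mem_shiftedPart (.fn i f))
    | vec k X =>
      cases l with
      | fn j f' =>
        have := (jacobi_vec_fn_fn X f' f).rotate (ofVec_mem_shiftedPart X)
          (gen_mem_shiftedPart (.fn j f')) (gen_mem_shiftedPart (.fn i f))
        simpa [Gen.totalDeg] using this
      | vec p Y =>
        have := (jacobi_vec_vec_fn X Y f).rotate (ofVec_mem_shiftedPart X)
          (ofVec_mem_shiftedPart Y) (gen_mem_shiftedPart (.fn i f))
        simpa [Gen.totalDeg] using this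
  | vec k X =>
    cases h with
    | fn i f =>
      cases l with
      | fn j f' => simpa [Gen.totalDeg] using jacobi_vec_fn_fn X f f'
      | vec p Y =>
        have := (jacobi_vec_vec_fn Y X f).rotate (ofVec_mem_shiftedPart Y)
          (ofVec_mem_shiftedPart X) (gen_mem_shiftedPart (.fn i f))
        have := this.rotate (gen_mem_shiftedPart (.fn i f)) (ofVec_mem_shiftedPart Y)
          (ofVec_mem_shiftedPart X)
        simpa [Gen.totalDeg] using this
    | vec p Y =>
      cases l with
      | fn j f => simpa [Gen.totalDeg] using jacobi_vec_vec_fn X Y f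
      | vec q Z => simpa [Gen.totalDeg] using jacobi_vec_vec_vec X Y Z

/-- `of_gen` frees the third slot and `rotate` moves the freed element to the front. Starting from
generators, the triples run through `(g, h, z)`, `(z, g, h)`, `(z, g, w)`; the last, taken as `(b,
g, a)`, rotates to `(a, b, g)` and yields `(a, b, c)`. -/
theorem schouten_jacobi {i j : ℤ} {a b : MultiVec 𝒜} (ha : a ∈ shiftedPart 𝒜 i)
    (hb : b ∈ shiftedPart 𝒜 j) (c : MultiVec 𝒜) : Jacobi i j a b c := by
  have hg := @gen_mem_shiftedPart A _ _ 𝒜 _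
  have one_gen : ∀ {k : ℤ} {z : MultiVec 𝒜}, z ∈ shiftedPart 𝒜 k → ∀ (g : Gen 𝒜) (w),
      Jacobi k (g.totalDeg - 1) z (gen g) w := fun hz g =>
    .of_gen hz (hg g) fun h => (Jacobi.of_gen (hg g) (hg h) (jacobi_gen g h) _).rotate (hg g)
      (hg h) hz
  exact .of_gen ha hb (fun g => (one_gen hb g a).rotate hb (hg g) ha) c

/-! ### The gradings -/

/-- Each projection keeps or kills a whole word, and a word has a definite multiplicity; hence
multiplicity is preserved. -/
theorem exists_shiftedPart_proj : ∃ P : ℤ → MultiVec 𝒜 →ₗ[ℝ] MultiVec 𝒜,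
    IsProjFamily (shiftedPart 𝒜) P ∧ ∀ i l, ∀ z ∈ multPart 𝒜 l, P i z ∈ multPart 𝒜 l := by
  obtain ⟨P, hP⟩ := exists_proj (𝒜 := 𝒜) Gen.totalDeg (fun k => k) (fun k => k + 1)
    (fun _ _ => rfl) (fun _ _ => rfl) rfl (fun _ _ => rfl) (fun _ _ => add_assoc _ _ _)
  -- The index is raised by one to pass from shifted to total degree.
  refine ⟨fun i => P (i + 1), fun j z hz i => ?_, fun i l z hz => ?_⟩
  · induction hz using Submodule.span_induction with
    | zero => simp
    | add x y _ _ hx hy => rw [map_add, hx, hy]; split_ifs <;> simp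
    | smul r x _ hx => rw [map_smul, hx]; split_ifs <;> simp
    | mem x hx =>
      obtain ⟨L, hL, rfl⟩ := hx
      simp [hP L, hL]
  · induction hz using Submodule.span_induction with
    | zero => simp
    | add x y _ _ hx hy => rw [map_add]; exact add_mem hx hy
    | smul r x _ hx => rw [map_smul]; exact Submodule.smul_mem _ _ hx
    | mem x hx =>
      obtain ⟨L, rfl, rfl⟩ := hx
      rw [hP L]
      split_ifs
      · exact prod_mem_degPart L
      · exact zero_mem _

theorem prod_mem_shiftedPart (L : List (Gen 𝒜)) :
    (L.map gen).prod ∈ shiftedPart 𝒜 ((L.map Gen.totalDeg).sum - 1) := by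
  simpa [shiftedPart] using! prod_mem_degPart (γ := gen) (deg := Gen.totalDeg) L

theorem shiftedPart_isInternal : DirectSum.IsInternal (shiftedPart 𝒜) := by
  obtain ⟨P, hP, -⟩ := exists_shiftedPart_proj (𝒜 := 𝒜)
  refine hP.isInternal (eq_top_iff.2 ?_)
  rw [← span_words, Submodule.span_le]
  rintro _ ⟨L, rfl⟩
  exact Submodule.mem_iSup_of_mem _ (prod_mem_shiftedPart L)

theorem shiftedPart_comap_isInternal (l : ℤ) :
    DirectSum.IsInternal fun k => (shiftedPart 𝒜 k).comap (multPart 𝒜 l).subtype := by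
  obtain ⟨P, hP, hPm⟩ := exists_shiftedPart_proj (𝒜 := 𝒜)
  refine IsProjFamily.isInternal (P := fun i => (P i).restrict (hPm i l)) (fun j z hz i => ?_) ?_
  · refine Subtype.ext ?_
    rw [LinearMap.coe_restrict_apply, hP j z.1 hz i]
    split_ifs <;> rfl
  · refine Submodule.map_injective_of_injective (multPart 𝒜 l).injective_subtype ?_
    rw [Submodule.map_iSup, Submodule.map_top, Submodule.range_subtype]
    refine le_antisymm (iSup_le fun i => Submodule.map_subtype_le _ _) ?_
    conv_lhs => rw [multPart, degPart]
    rw [Submodule.span_le]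
    rintro _ ⟨L, rfl, rfl⟩
    exact Submodule.mem_iSup_of_mem _
      ⟨⟨_, prod_mem_degPart L⟩, prod_mem_shiftedPart L, rfl⟩

/-! ### The bracket lowers the multiplicity by one -/

theorem genBracket_mem_multPart (g h : Gen 𝒜) :
    genBracket g h ∈ multPart 𝒜 (g.mult - 1 + h.mult) := by
  cases g with
  | fn i f =>
    cases h with
    -- The prescribed multiplicity is `-1` here, but the bracket is zero.
    | fn j f' => exact zero_mem _
    | vec k X => exact neg_mem (Submodule.smul_mem _ _ (gen_mem_degPart (Gen.fn _ (applyFn X f))))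
  | vec k X =>
    cases h with
    | fn j f => exact gen_mem_degPart (Gen.fn _ (applyFn X f))
    | vec l Y => exact gen_mem_degPart (Gen.vec _ (commutator X Y))

/-- The change of multiplicity `l` is independent of the degree `k`, which enters only through
signs. -/
theorem IsDer.mem_multPart {k l : ℤ} {D : MultiVec 𝒜 →ₗ[ℝ] MultiVec 𝒜} (h : IsDer k D)
    (hg : ∀ g, D (gen g) ∈ multPart 𝒜 (l + g.mult)) {i : ℤ} {z : MultiVec 𝒜}
    (hz : z ∈ multPart 𝒜 i) : D z ∈ multPart 𝒜 (l + i) := by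
  induction hz using Submodule.span_induction with
  | zero => simp
  | add x y _ _ hx hy => rw [_root_.map_add]; exact add_mem hx hy
  | smul r x _ hx => rw [_root_.map_smul]; exact Submodule.smul_mem _ _ hx
  | mem x hx =>
    obtain ⟨L, rfl, rfl⟩ := hx
    induction L with
    | nil => simp [h.map_one]
    | cons g L ih =>
      simp only [List.map_cons, List.prod_cons, List.sum_cons]
      rw [h _ _ (gen_mem g)]
      refine add_mem ?_ (Submodule.smul_mem _ _ ?_)
      · rw [← add_assoc]
        exact mul_mem_degPart (hg g) (prod_mem_degPart L)
      · rw [add_left_comm]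
        exact mul_mem_degPart (gen_mem_degPart g) ih

/-- An element of fixed multiplicity may mix shifted degrees, so `a` is first reduced to a word;
then `[a, ·]` is a derivation and antisymmetry again leads to pairs of generators. -/
theorem schouten_mem_multPart {i j : ℤ} {a b : MultiVec 𝒜} (ha : a ∈ multPart 𝒜 i)
    (hb : b ∈ multPart 𝒜 j) : schouten 𝒜 a b ∈ multPart 𝒜 (i - 1 + j) := by
  induction ha using Submodule.span_induction with
  | zero => simp
  | add x y _ _ hx hy => rw [map_add]; exact add_mem hx hy
  | smul r x _ hx => rw [map_smul]; exact Submodule.smul_mem _ _ hx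
  | mem x hx =>
    obtain ⟨L, rfl, rfl⟩ := hx
    refine (schouten_isDer (prod_mem_shiftedPart L)).mem_multPart (fun g => ?_) hb
    rw [schouten_antisymm (gen_mem_shiftedPart g) (prod_mem_shiftedPart L)]
    refine neg_mem (Submodule.smul_mem _ _ ?_)
    have := (schouten_isDer (gen_mem_shiftedPart g)).mem_multPart
      (fun h => by rw [schouten_gen]; exact genBracket_mem_multPart g h) (prod_mem_degPart L)
    convert! this using 2
    ring

/-! ### Blended structures -/

theorem schouten_isGradedLieAlgebra : IsGradedLieAlgebra (shiftedPart 𝒜) (schouten 𝒜) where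
  isInternal := shiftedPart_isInternal
  degree := schouten_mem_shiftedPart
  antisymm := schouten_antisymm
  jacobi ha hb _ := schouten_jacobi ha hb _

theorem schouten_isLieDerivation {k : ℤ} {z : MultiVec 𝒜} (hz : z ∈ shiftedPart 𝒜 k) :
    IsLieDerivation (shiftedPart 𝒜) (schouten 𝒜) k (schouten 𝒜 z) where
  degree ha := by
    rw [add_comm]
    exact schouten_mem_shiftedPart hz ha
  leibniz ha _ := schouten_jacobi hz ha _

/-- For odd `z` the Jacobi identity reads `[z, [z, c]] = [[z, z], c] - [z, [z, c]]`, so twice the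
square vanishes. -/
theorem schouten_comp_self {k : ℤ} (hk : Odd k) {z : MultiVec 𝒜} (hz : z ∈ shiftedPart 𝒜 k)
    (h : schouten 𝒜 z z = 0) : schouten 𝒜 z ∘ₗ schouten 𝒜 z = 0 := by
  ext c
  have := schouten_jacobi hz hz c
  rw [Jacobi, h, (hk.mul hk).neg_one_zpow, LinearMap.map_zero, LinearMap.zero_apply, zero_add,
    neg_one_smul] at this
  have h2 : (2 : ℝ) • schouten 𝒜 z (schouten 𝒜 z c) = 0 := by
    rw [two_smul]
    exact eq_neg_iff_add_eq_zero.1 this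
  exact (smul_eq_zero_iff_right two_ne_zero).1 h2

theorem IsBlendedPair.isBlendedDGLA {Qp Qm : MultiVec 𝒜} (h : IsBlendedPair Qp Qm) :
    IsBlendedDGLA (shiftedPart 𝒜) (schouten 𝒜) (schouten 𝒜 Qp) (schouten 𝒜 Qm) where
  gradedLie := schouten_isGradedLieAlgebra
  derivation_pos := schouten_isLieDerivation h.pos_mem
  derivation_neg := schouten_isLieDerivation h.neg_mem
  sq_pos := schouten_comp_self odd_one h.pos_mem h.pos_homological
  sq_neg := schouten_comp_self (by decide) h.neg_mem h.neg_homological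
  compatible := by
    ext c
    -- The sign attached to degrees `1` and `-1` is `-1`, so the identity expresses the
    -- anticommutator as `[[Q⁺, Q⁻], ·]`.
    have := schouten_jacobi h.pos_mem h.neg_mem c
    rw [Jacobi, h.compatible] at this
    simp [this]

/-- The compatible components of an element of shifted degrees `1` and `-1` are detected by its
square. -/
theorem isBlendedPair_iff {Qp Qm : MultiVec 𝒜} (hp : Qp ∈ shiftedPart 𝒜 1)
    (hm : Qm ∈ shiftedPart 𝒜 (-1)) :
    IsBlendedPair Qp Qm ↔ schouten 𝒜 (Qp + Qm) (Qp + Qm) = 0 := by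
  have hanti : schouten 𝒜 Qm Qp = schouten 𝒜 Qp Qm := by
    simpa using schouten_antisymm hp hm
  have hexp : schouten 𝒜 (Qp + Qm) (Qp + Qm) =
      schouten 𝒜 Qp Qp + (2 : ℝ) • schouten 𝒜 Qp Qm + schouten 𝒜 Qm Qm := by
    simp only [map_add, LinearMap.add_apply, hanti, two_smul]
    abel
  rw [hexp]
  refine ⟨fun h => by simp [h.pos_homological, h.neg_homological, h.compatible], fun h => ?_⟩
  -- The three terms have shifted degrees `2`, `0` and `-2`, so the projections separate them.
  obtain ⟨P, hP, -⟩ := exists_shiftedPart_proj (𝒜 := 𝒜)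
  have e1 := hP _ _ (schouten_mem_shiftedPart hp hp)
  have e2 := hP _ _ (schouten_mem_shiftedPart hp hm)
  have e3 := hP _ _ (schouten_mem_shiftedPart hm hm)
  refine ⟨hp, hm, ?_, ?_, ?_⟩
  · simpa [e1, e2, e3] using congrArg (P 2) h
  · simpa [e1, e2, e3] using congrArg (P (-2)) h
  · simpa [e1, e2, e3] using congrArg (P 0) h

theorem IsBlendedPair.isDeformation_iff {Qp Qm : MultiVec 𝒜} (h : IsBlendedPair Qp Qm)
    (Qt : MultiVec 𝒜) : IsDeformation (Qp + Qm) Qt ↔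
      IsMaurerCartan (shiftedPart 𝒜) (schouten 𝒜) (schouten 𝒜 Qp) (schouten 𝒜 Qm) Qt := by
  obtain ⟨P, hP, -⟩ := exists_shiftedPart_proj (𝒜 := 𝒜)
  refine and_congr_right ?_
  rintro ⟨p, hp, q, hq, rfl⟩
  have hpp := add_mem h.pos_mem hp
  have hmm := add_mem h.neg_mem hq
  have e : Qp + Qm + (p + q) = (Qp + p) + (Qm + q) := by abel
  -- A blended decomposition of the sum is forced: its parts of degrees `1` and `-1` are unique.
  have hiff : IsBlendedHomological (Qp + Qm + (p + q)) ↔ IsBlendedPair (Qp + p) (Qm + q) := by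
    refine ⟨?_, fun h' => ⟨_, _, h', e⟩⟩
    rintro ⟨Rp, Rm, hR, hsum⟩
    obtain ⟨rfl, rfl⟩ := hP.eq_of_add_eq (by decide) hpp hR.pos_mem hmm hR.neg_mem (e ▸ hsum)
    exact hR
  -- The bracket is symmetric on elements of odd shifted degree, so the cross terms double.
  have a1 : schouten 𝒜 p Qp = schouten 𝒜 Qp p := by simpa using schouten_antisymm h.pos_mem hp
  have a2 : schouten 𝒜 p Qm = schouten 𝒜 Qm p := by simpa using schouten_antisymm h.neg_mem hp
  have a3 : schouten 𝒜 q Qp = schouten 𝒜 Qp q := by simpa using schouten_antisymm h.pos_mem hq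
  have a4 : schouten 𝒜 q Qm = schouten 𝒜 Qm q := by simpa using schouten_antisymm h.neg_mem hq
  have h0 := (isBlendedPair_iff h.pos_mem h.neg_mem).1 h
  have hexp : schouten 𝒜 (Qp + Qm + (p + q)) (Qp + Qm + (p + q)) =
      (2 : ℝ) • ((schouten 𝒜 Qp + schouten 𝒜 Qm) (p + q) +
        (1 / 2 : ℝ) • schouten 𝒜 (p + q) (p + q)) := by
    rw [map_add (schouten 𝒜) (Qp + Qm), LinearMap.add_apply, map_add (schouten 𝒜 (Qp + Qm)), h0,
      smul_add, smul_smul]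
    simp only [map_add, LinearMap.add_apply, a1, a2, a3, a4, two_smul]
    norm_num
    abel
  rw [hiff, isBlendedPair_iff hpp hmm, ← e, hexp, smul_eq_zero_iff_right two_ne_zero]

/-- The components of a multi-vector field of multiplicity `l` have multiplicity `l`. -/
theorem mem_multPart_of_add {i j l : ℤ} (hij : i ≠ j) {a b : MultiVec 𝒜}
    (ha : a ∈ shiftedPart 𝒜 i) (hb : b ∈ shiftedPart 𝒜 j) (h : a + b ∈ multPart 𝒜 l) :
    a ∈ multPart 𝒜 l ∧ b ∈ multPart 𝒜 l := by
  obtain ⟨P, hP, hPm⟩ := exists_shiftedPart_proj (𝒜 := 𝒜)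
  constructor
  · simpa [hP _ _ ha, hP _ _ hb, hij.symm] using hPm i l _ h
  · simpa [hP _ _ ha, hP _ _ hb, hij] using hPm j l _ h

theorem schouten_mem_multPart_one {a b : MultiVec 𝒜} (ha : a ∈ multPart 𝒜 1)
    (hb : b ∈ multPart 𝒜 1) : schouten 𝒜 a b ∈ multPart 𝒜 1 := by
  simpa using schouten_mem_multPart ha hb

end MultiVector

/-! ### Restriction to a graded Lie subalgebra -/

section Restrict

variable {V : Type*} [AddCommGroup V] [Module ℝ V] {𝒱 : ℤ → Submodule ℝ V}
  {br : V →ₗ[ℝ] V →ₗ[ℝ] V} {dp dm : V →ₗ[ℝ] V}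

/-- All identities are inherited by a stable subspace. The grading is not: `N` need not be spanned
by its homogeneous elements, whence `hN`. -/
theorem IsBlendedDGLA.restrict (h : IsBlendedDGLA 𝒱 br dp dm) {N : Submodule ℝ V}
    (hN : DirectSum.IsInternal fun k => (𝒱 k).comap N.subtype)
    (hbr : ∀ a ∈ N, ∀ b ∈ N, br a b ∈ N) (hp : ∀ a ∈ N, dp a ∈ N) (hm : ∀ a ∈ N, dm a ∈ N) :
    IsBlendedDGLA (fun k => (𝒱 k).comap N.subtype) (restrictBr N hbr) (dp.restrict hp)
      (dm.restrict hm) where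
  gradedLie :=
    { isInternal := hN
      degree := fun ha hb => h.gradedLie.degree ha hb
      antisymm := fun ha hb => Subtype.ext (h.gradedLie.antisymm ha hb)
      jacobi := fun ha hb hc => Subtype.ext (h.gradedLie.jacobi ha hb hc) }
  derivation_pos :=
    { degree := fun ha => h.derivation_pos.degree ha
      leibniz := fun ha hb => Subtype.ext (h.derivation_pos.leibniz ha hb) }
  derivation_neg :=
    { degree := fun ha => h.derivation_neg.degree ha
      leibniz := fun ha hb => Subtype.ext (h.derivation_neg.leibniz ha hb) }
  sq_pos := LinearMap.ext fun a => Subtype.ext (LinearMap.congr_fun h.sq_pos a.1)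
  sq_neg := LinearMap.ext fun a => Subtype.ext (LinearMap.congr_fun h.sq_neg a.1)
  compatible := LinearMap.ext fun a => Subtype.ext (LinearMap.congr_fun h.compatible a.1)

/-- The equation is the same in `N` and in `V`; what matters is that the components of `v` stay in
`N`, which `hN` supplies. -/
theorem isMaurerCartan_restrict_iff {N : Submodule ℝ V}
    (hbr : ∀ a ∈ N, ∀ b ∈ N, br a b ∈ N) (hp : ∀ a ∈ N, dp a ∈ N) (hm : ∀ a ∈ N, dm a ∈ N)
    (hN : ∀ a ∈ 𝒱 1, ∀ b ∈ 𝒱 (-1), a + b ∈ N → a ∈ N ∧ b ∈ N) (v : N) :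
    IsMaurerCartan (fun k => (𝒱 k).comap N.subtype) (restrictBr N hbr) (dp.restrict hp)
      (dm.restrict hm) v ↔ IsMaurerCartan 𝒱 br dp dm v := by
  refine and_congr ⟨?_, ?_⟩ ⟨fun h => congrArg Subtype.val h, fun h => Subtype.ext h⟩
  · rintro ⟨a, ha, b, hb, rfl⟩
    exact ⟨a, ha, b, hb, rfl⟩
  · rintro ⟨a, ha, b, hb, hv⟩
    obtain ⟨haN, hbN⟩ := hN a ha b hb (hv ▸ v.2)
    exact ⟨⟨a, haN⟩, ha, ⟨b, hbN⟩, hb, Subtype.ext hv⟩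

end Restrict

end BlendedQ

/-! ### The theorem for graded manifolds -/

open BlendedQ in
theorem mainTheorem1 {m n : ℕ} {M : Type*} [TopologicalSpace M] [T2Space M] [SigmaCompactSpace M]
    [ChartedSpace (EuclideanSpace ℝ (Fin m)) M] [IsManifold (𝓡 m) ∞ M]
    (𝓔 : GradedManifold m n M) (Q Qp Qm : 𝓔.MultiVectorField)
    (hpair : IsBlendedPair Qp Qm) (hQ : Q = Qp + Qm) :
    (IsBlendedDGLA 𝓔.shifted 𝓔.bracket (𝓔.bracket Qp) (𝓔.bracket Qm) ∧
      ∀ Qt : 𝓔.MultiVectorField, IsDeformation Q Qt ↔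
        IsMaurerCartan 𝓔.shifted 𝓔.bracket (𝓔.bracket Qp) (𝓔.bracket Qm) Qt) ∧
    (Q ∈ 𝓔.univectors →
      ∃ (hbr : ∀ X ∈ 𝓔.univectors, ∀ Y ∈ 𝓔.univectors, 𝓔.bracket X Y ∈ 𝓔.univectors)
        (hp : ∀ X ∈ 𝓔.univectors, 𝓔.bracket Qp X ∈ 𝓔.univectors)
        (hm : ∀ X ∈ 𝓔.univectors, 𝓔.bracket Qm X ∈ 𝓔.univectors),
        IsBlendedDGLA 𝓔.shiftedUnivectors (restrictBr 𝓔.univectors hbr)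
            ((𝓔.bracket Qp).restrict hp) ((𝓔.bracket Qm).restrict hm) ∧
          ∀ Qt : 𝓔.univectors, IsDeformation Q (Qt : 𝓔.MultiVectorField) ↔
            IsMaurerCartan 𝓔.shiftedUnivectors (restrictBr 𝓔.univectors hbr)
              ((𝓔.bracket Qp).restrict hp) ((𝓔.bracket Qm).restrict hm) Qt) := by
  subst hQ
  have hN : ∀ a ∈ 𝓔.shifted 1, ∀ b ∈ 𝓔.shifted (-1), a + b ∈ 𝓔.univectors →
      a ∈ 𝓔.univectors ∧ b ∈ 𝓔.univectors := fun a ha b hb h =>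
    mem_multPart_of_add (by decide) ha hb h
  refine ⟨⟨hpair.isBlendedDGLA, hpair.isDeformation_iff⟩, fun hQ => ?_⟩
  -- Multiplicity one of the sum passes to `Q⁺` and `Q⁻`, which is what makes both differentials
  -- preserve `𝔛¹`.
  obtain ⟨hQp, hQm⟩ := hN Qp hpair.pos_mem Qm hpair.neg_mem hQ
  refine ⟨fun X hX Y hY => schouten_mem_multPart_one hX hY,
    fun X hX => schouten_mem_multPart_one hQp hX, fun X hX => schouten_mem_multPart_one hQm hX,
    hpair.isBlendedDGLA.restrict (shiftedPart_comap_isInternal 1) _ _ _, fun Qt => ?_⟩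
  rw [hpair.isDeformation_iff, isMaurerCartan_restrict_iff _ _ _ hN]
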